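/- Let $\mathbb K\in\{\mathbb R,\mathbb C\}$ and let $F_1\hookrightarrow F_0$ be a densely and compactly injected couple of Banach spaces over $\mathbb K$. For each $\theta\in(0,1)$ let $(\cdot,\cdot)_\theta$ be an arbitrary admissible interpolation functor of exponent $\theta$ (i.e. an interpolation functor of exponent $\theta$ such that $X_1$ is dense in $(X_0,X_1)_\theta$ whenever $X_1$ is densely injected in $X_0$), and set $F_\theta:=(F_0,F_1)_\theta$, where $(X_0,X_1)_0:=X_0$ and $(X_0,X_1)_1:=X_1$. For Banach spaces $E_1\hookrightarrow E_0$ let $\mathcal H(E_1,E_0)\subset\mathcal L(E_1,E_0)$ be the set of generators, with domain $E_1$, of strongly continuous analytic semigroups on $E_0$. Fix $$0\le\theta_0<\theta_1<\theta_2<\theta_3<\theta_4<\theta_5\le 1,$$ let $O\subset F_{\theta_2}$ be open, and assume $$A\in C^1\big(O\cap F_{\theta_3},\mathcal H(F_{\theta_5},F_{\theta_1})\big)\cap C^1\big(O,\mathcal H(F_{\theta_4},F_{\theta_0})\big),\qquad f\in C^1\big(O\cap F_{\theta_3},F_{\theta_1}\big).$$ Let $u_*\in F_{\theta_5}\cap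 O$ and set $A_*:=A(u_*)+(\partial A(u_*)[\cdot])u_*+\partial f(u_*)$. We say that $0$ is a semi-simple eigenvalue of $B\in\mathcal L(E_1,E_0)$ if $\ker B\ne\{0\}$, $\operatorname{rg}B$ is closed in $E_0$, and $E_0=\ker B\oplus\operatorname{rg}B$. Then $A_*\in\mathcal H(F_{\theta_5},F_{\theta_1})\cap\mathcal H(F_{\theta_4},F_{\theta_0})$. If $0$ is a semi-simple eigenvalue of $A_*\in\mathcal L(F_{\theta_5},F_{\theta_1})$, then $0$ is also a semi-simple eigenvalue of $A_*\in\mathcal L(F_{\theta_4},F_{\theta_0})$. Moreover, in this case: 1. The spectral projections $P_1\in\mathcal L(F_{\theta_1})$ of $A_*\in\mathcal L(F_{\theta_5},F_{\theta_1})$ and $P_0\in\mathcal L(F_{\theta_0})$ of $A_*\in\mathcal L(F_{\theta_4},F_{\theta_0})$ corresponding to the spectral set $\{0\}$ exist, $P_0$ extends $P_1$, each is a projection onto the kernel of the respective operator, and $P_0(F_{\theta_0})=P_1(F_{\theta_1})$. Furthermore $P_0(F_{\theta_0})$, with the norm of $F_{\theta_0}$, is continuously embedded in $\ker A_*\subset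 F_{\theta_5}$, with the norm of $F_{\theta_5}$. 2. Let $E_\theta:=(F_{\theta_1},F_{\theta_5})_\theta$, $\theta\in[0,1]$, be formed with any (possibly different) admissible interpolation functors. There is $\zeta\in[0,1)$ with $E_\zeta\hookrightarrow F_{\theta_4}$. 3. There are an open neighbourhood $U\subset O$ of $u_*$ in $F_{\theta_2}$ and $L\ge0$ such that $$\|A(w)-A(u_*)\|_{\mathcal L(F_{\theta_4},F_{\theta_0})}\le L\,\|w-u_*\|_{F_{\theta_2}},\qquad w\in U.$$ If $\beta\in(0,1)$ satisfies $(1-\beta)\theta_1+\beta\theta_5>\theta_2$, then $E_\beta\hookrightarrow F_{\theta_2}$, and for some open neighbourhood $U_\beta\subset O\cap E_\beta$ of $u_*$ in $E_\beta$ and some $L_\beta\ge0$ one has $\|A(w)-A(u_*)\|_{\mathcal L(F_{\theta_4},F_{\theta_0})}\le L_\beta\|w-u_*\|_{E_\beta}$ for all $w\in U_\beta$. -/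

import Mathlib

universe u
/-- A Banach space over `𝕜`. -/
structure Ban (𝕜 : Type) [RCLike 𝕜] where
  carrier : Type u
  [normed : NormedAddCommGroup carrier]
  [space : NormedSpace 𝕜 carrier]
  [complete : CompleteSpace carrier]

attribute [instance] Ban.normed Ban.space Ban.complete

instance {𝕜 : Type} [RCLike 𝕜] : CoeSort (Ban.{u} 𝕜) (Type u) := ⟨Ban.carrier⟩

/-- A Banach couple: two Banach spaces continuously embedded in a common Hausdorff topological
vector space `V`. -/
structure BanachCouple (𝕜 : Type) [RCLike 𝕜] where
  V : Type u
  [addV : AddCommGroup V]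
  [modV : Module 𝕜 V]
  [topV : TopologicalSpace V]
  [groupV : IsTopologicalAddGroup V]
  [smulV : ContinuousSMul 𝕜 V]
  [t2V : T2Space V]
  X₀ : Ban.{u} 𝕜
  X₁ : Ban.{u} 𝕜
  ι₀ : X₀ →L[𝕜] V
  ι₁ : X₁ →L[𝕜] V
  inj₀ : Function.Injective ι₀
  inj₁ : Function.Injective ι₁

attribute [instance] BanachCouple.addV BanachCouple.modV BanachCouple.topV
  BanachCouple.groupV BanachCouple.smulV BanachCouple.t2V

/-- A morphism of Banach couples: a linear map `X₀ + X₁ → Y₀ + Y₁`, given by its bounded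
restrictions `T₀ : X₀ → Y₀` and `T₁ : X₁ → Y₁`, which agree on `X₀ ∩ X₁`. -/
structure CoupleHom {𝕜 : Type} [RCLike 𝕜] (X Y : BanachCouple.{u} 𝕜) where
  T₀ : X.X₀ →L[𝕜] Y.X₀
  T₁ : X.X₁ →L[𝕜] Y.X₁
  agree : ∀ a b, X.ι₀ a = X.ι₁ b → Y.ι₀ (T₀ a) = Y.ι₁ (T₁ b)

/-- An interpolation functor: it assigns to a Banach couple `X` a Banach space `obj X`, realised
inside `X₀ + X₁ ⊆ V` by `emb X`, with continuous embeddings `X₀ ∩ X₁ ↪ obj X ↪ X₀ + X₁`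
(fields `inter_le` and `le_sum`, for the usual norms of the intersection and of the sum), such that
every morphism of couples restricts to a bounded operator `obj X → obj Y` (fields `map` and
`map_emb`; the restriction is unique, so functoriality is automatic). -/
structure InterpolationFunctor (𝕜 : Type) [RCLike 𝕜] where
  obj : BanachCouple.{u} 𝕜 → Ban.{u} 𝕜
  emb : ∀ X, obj X →ₗ[𝕜] X.V
  emb_inj : ∀ X, Function.Injective (emb X)
  inter_le : ∀ X, ∃ C : ℝ, ∀ a b, X.ι₀ a = X.ι₁ b →
    ∃ x, emb X x = X.ι₀ a ∧ ‖x‖ ≤ C * max ‖a‖ ‖b‖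
  le_sum : ∀ X, ∃ C : ℝ, ∀ x, ∃ a b, emb X x = X.ι₀ a + X.ι₁ b ∧ ‖a‖ + ‖b‖ ≤ C * ‖x‖
  map : ∀ {X Y}, CoupleHom X Y → (obj X →L[𝕜] obj Y)
  map_emb : ∀ {X Y} (T : CoupleHom X Y) x a b, emb X x = X.ι₀ a + X.ι₁ b →
    emb Y (map T x) = Y.ι₀ (T.T₀ a) + Y.ι₁ (T.T₁ b)

/-- A couple `E₁ ↪ E₀` of Banach spaces, with a continuous linear injection. -/
structure InjectedCouple (𝕜 : Type) [RCLike 𝕜] where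
  E₀ : Ban.{u} 𝕜
  E₁ : Ban.{u} 𝕜
  inj : E₁ →L[𝕜] E₀
  injective : Function.Injective inj

/-- `E₁ ↪ E₀` as a Banach couple inside `V = E₀`. -/
def InjectedCouple.toCouple {𝕜 : Type} [RCLike 𝕜] (D : InjectedCouple.{u} 𝕜) :
    BanachCouple.{u} 𝕜 where
  V := D.E₀
  X₀ := D.E₀
  X₁ := D.E₁
  ι₀ := ContinuousLinearMap.id 𝕜 D.E₀
  ι₁ := D.inj
  inj₀ := Function.injective_id
  inj₁ := D.injective

namespace InterpolationFunctor

/-- `G` is of exponent `θ`: `‖T‖_{G(X) → G(Y)} ≤ c ‖T₀‖^(1-θ) ‖T₁‖^θ` for all morphisms `T : X → Y`,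
where `c` may depend on the two couples. -/
def HasExponent {𝕜 : Type} [RCLike 𝕜] (G : InterpolationFunctor.{u} 𝕜) (θ : ℝ) : Prop :=
  ∀ X Y : BanachCouple.{u} 𝕜, ∃ c : ℝ, ∀ T : CoupleHom X Y,
    ‖G.map T‖ ≤ c * (‖T.T₀‖ ^ (1 - θ) * ‖T.T₁‖ ^ θ)

end InterpolationFunctor

section aux
open scoped Pointwise
variable {𝕜 : Type} [RCLike 𝕜]

/-- The embedding of the interpolation space of `E₁ ↪ E₀` into `E₀`. -/
abbrev InjectedCouple.emb (D : InjectedCouple.{u} 𝕜) (G : InterpolationFunctor.{u} 𝕜) :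
    G.obj D.toCouple →ₗ[𝕜] D.E₀ := G.emb D.toCouple

theorem InjectedCouple.emb_bound (D : InjectedCouple.{u} 𝕜) (G : InterpolationFunctor.{u} 𝕜) :
    ∃ C : ℝ, ∀ x, ‖D.emb G x‖ ≤ C * ‖x‖ := by
  obtain ⟨C, hC⟩ := G.le_sum D.toCouple
  refine ⟨(1 + ‖D.inj‖) * |C|, fun x => ?_⟩
  obtain ⟨a, b, h, hab⟩ := hC x
  have h' : D.emb G x = (show D.E₀ from a) + D.inj b := h
  rw [h']
  have h1 : ‖(show D.E₀ from a) + D.inj b‖ ≤ ‖a‖ + ‖D.inj b‖ := norm_add_le (show D.E₀ from a) (D.inj b)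
  have h2 := D.inj.le_opNorm b
  have h3 : ‖a‖ + ‖b‖ ≤ |C| * ‖x‖ := hab.trans (by gcongr; exact le_abs_self C)
  have ha : 0 ≤ ‖a‖ := norm_nonneg a
  have hb : 0 ≤ ‖b‖ := norm_nonneg b
  have hj : 0 ≤ ‖D.inj‖ := norm_nonneg _
  change ‖a‖ + ‖b‖ ≤ _ at h3
  calc _ ≤ ‖a‖ + ‖D.inj‖ * ‖b‖ := h1.trans (by gcongr; exact h2)
    _ ≤ (1 + ‖D.inj‖) * (‖a‖ + ‖b‖) := by nlinarith
    _ ≤ (1 + ‖D.inj‖) * (|C| * ‖x‖) := by gcongr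
    _ = _ := by ring

/-- The couple of scalar fields `𝕜 ↪ 𝕜`. -/
def scalarCouple (𝕜 : Type) [RCLike 𝕜] : BanachCouple.{u} 𝕜 :=
  InjectedCouple.toCouple ⟨⟨ULift.{u} 𝕜⟩, ⟨ULift.{u} 𝕜⟩, ContinuousLinearMap.id 𝕜 _,
    Function.injective_id⟩

theorem InjectedCouple.emb_eq (D : InjectedCouple.{u} 𝕜) (G : InterpolationFunctor.{u} 𝕜)
    {Y} (T : CoupleHom D.toCouple Y) (x) :
    G.emb Y (G.map T x) = Y.ι₀ (T.T₀ (D.emb G x)) := by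
  have := G.map_emb T x (D.emb G x) 0 (by
    rw [map_zero, add_zero]; rfl)
  rw [map_zero, map_zero, add_zero] at this
  exact this

/-- The scalar field lifted to the universe at hand. -/
def scalarUp (𝕜 : Type) [RCLike 𝕜] : 𝕜 →L[𝕜] ULift.{u} 𝕜 :=
  (ContinuousLinearEquiv.ulift (R₁ := 𝕜) (M₁ := 𝕜)).symm.toContinuousLinearMap

theorem norm_scalarUp_comp {E : Type u} [NormedAddCommGroup E] [NormedSpace 𝕜 E] (f : E →L[𝕜] 𝕜) :
    ‖(scalarUp.{u} 𝕜).comp f‖ = ‖f‖ := by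
  apply le_antisymm
  · refine ContinuousLinearMap.opNorm_le_bound _ (norm_nonneg _) fun x => ?_
    exact f.le_opNorm x
  · refine ContinuousLinearMap.opNorm_le_bound _ (norm_nonneg _) fun x => ?_
    exact ((scalarUp.{u} 𝕜).comp f).le_opNorm x

theorem InjectedCouple.exists_decomp (D : InjectedCouple.{u} 𝕜) {G : InterpolationFunctor.{u} 𝕜}
    {θ : ℝ} (h0 : 0 ≤ θ) (h1 : θ ≤ 1) (hG : G.HasExponent θ) :
    ∃ C : ℝ, 0 ≤ C ∧ ∀ x (t M : ℝ), 0 < t → C * (t ^ θ * ‖x‖) < M →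
      ∃ a b, D.emb G x = a + D.inj b ∧ ‖a‖ ≤ M ∧ t * ‖b‖ ≤ M := by
  obtain ⟨c, hc⟩ := hG D.toCouple (scalarCouple 𝕜)
  obtain ⟨K, hK⟩ := G.le_sum (scalarCouple.{u} 𝕜)
  have key : ∀ x (t : ℝ), 0 < t → |K| * |c| * (t ^ θ * ‖x‖) < 1 →
      ∃ a b, D.emb G x = a + D.inj b ∧ ‖a‖ < 1 ∧ t * ‖b‖ < 1 := by
    intro x t ht hx
    by_contra hcon
    let _ : NormedSpace ℝ D.E₀ := NormedSpace.restrictScalars ℝ 𝕜 D.E₀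
    let _ : NormedSpace ℝ D.E₁ := NormedSpace.restrictScalars ℝ 𝕜 D.E₁
    have _ : IsScalarTower ℝ 𝕜 D.E₀ := inferInstance
    let s : Set D.E₀ := Metric.ball (0 : D.E₀) 1 + (D.inj.toLinearMap.restrictScalars ℝ) ''
      (Metric.ball (0 : D.E₁) t⁻¹)
    have hs1 : Convex ℝ s :=
      (convex_ball _ _).add ((convex_ball _ _).linear_image _)
    have hs2 : IsOpen s := Metric.isOpen_ball.add_right
    have hs3 : D.emb G x ∉ s := by
      rintro ⟨a, ha, _, ⟨b, hb, rfl⟩, hab⟩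
      refine hcon ⟨a, b, hab.symm, by simpa using ha, ?_⟩
      have hb' : ‖b‖ < t⁻¹ := by simpa using hb
      calc t * ‖b‖ < t * t⁻¹ := by gcongr
        _ = 1 := mul_inv_cancel₀ ht.ne'
    obtain ⟨f, hf⟩ := RCLike.geometric_hahn_banach_open_point (𝕜 := 𝕜) hs1 hs2 hs3
    set σ := RCLike.re (f (D.emb G x)) with hσ
    have hσ0 : 0 < σ := by
      have := hf 0 ⟨0, by simp, 0, ⟨0, by simp [ht], by simp⟩, by simp⟩
      simpa using this
    -- a functional whose real part stays below `σ` on multiples is bounded by `σ`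
    have phase : ∀ w : 𝕜, w ≠ 0 → ∃ z : 𝕜, ‖z‖ = σ / ‖w‖ ∧ RCLike.re (z * w) = σ := by
      intro w hw
      have hw' : ‖w‖ ≠ 0 := by simpa using hw
      refine ⟨((σ / ‖w‖ : ℝ) : 𝕜) * ((‖w‖ : 𝕜) / w), ?_, ?_⟩
      · simp [hw', abs_of_pos hσ0]
      · have : ((σ / ‖w‖ : ℝ) : 𝕜) * ((‖w‖ : 𝕜) / w) * w = ((σ : ℝ) : 𝕜) := by
          have : (‖w‖ : 𝕜) ≠ 0 := by exact_mod_cast hw'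
          push_cast
          field_simp
        rw [this, RCLike.ofReal_re]
    have hfa : ∀ a, ‖f a‖ ≤ σ * ‖a‖ := by
      intro a
      by_contra hlt
      push Not at hlt
      have h0 : 0 < ‖f a‖ := lt_of_le_of_lt (by positivity) hlt
      obtain ⟨z, hz1, hz2⟩ := phase (f a) (norm_pos_iff.1 h0)
      have hmem : z • a ∈ s := by
        refine ⟨z • a, ?_, 0, ⟨0, by simp [ht], by simp⟩, by simp⟩
        rw [mem_ball_zero_iff, norm_smul, hz1, div_mul_eq_mul_div, div_lt_one h0]
        exact hlt
      have := hf _ hmem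
      rw [map_smul, smul_eq_mul, hz2] at this
      exact lt_irrefl _ this
    have hfb : ∀ b, ‖f (D.inj b)‖ ≤ σ * t * ‖b‖ := by
      intro b
      by_contra hlt
      push Not at hlt
      have h0 : 0 < ‖f (D.inj b)‖ := lt_of_le_of_lt (by positivity) hlt
      obtain ⟨z, hz1, hz2⟩ := phase (f (D.inj b)) (norm_pos_iff.1 h0)
      have hmem : z • D.inj b ∈ s := by
        refine ⟨0, by simp, z • D.inj b, ⟨z • b, ?_, by simp⟩, by simp⟩
        rw [mem_ball_zero_iff, norm_smul, hz1, div_mul_eq_mul_div, div_lt_iff₀ h0,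
          inv_mul_eq_div, lt_div_iff₀ ht]
        linarith
      have := hf _ hmem
      rw [map_smul, smul_eq_mul, hz2] at this
      exact lt_irrefl _ this
    let T : CoupleHom D.toCouple (scalarCouple.{u} 𝕜) :=
      { T₀ := (scalarUp.{u} 𝕜).comp f
        T₁ := (scalarUp.{u} 𝕜).comp (f.comp D.inj)
        agree := by
          intro a b hab
          have hab' : a = D.inj b := hab
          subst hab'
          rfl }
    have hT0 : ‖T.T₀‖ ≤ σ := by
      change ‖(scalarUp.{u} 𝕜).comp f‖ ≤ σ
      rw [norm_scalarUp_comp]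
      exact ContinuousLinearMap.opNorm_le_bound _ hσ0.le hfa
    have hT1 : ‖T.T₁‖ ≤ σ * t := by
      change ‖(scalarUp.{u} 𝕜).comp (f.comp D.inj)‖ ≤ σ * t
      rw [norm_scalarUp_comp]
      exact ContinuousLinearMap.opNorm_le_bound _ (by positivity) hfb
    have e1 := D.emb_eq G T x
    obtain ⟨a, b, hab, hn⟩ := hK (G.map T x)
    have e2 : ‖f (D.emb G x)‖ ≤ K * ‖G.map T x‖ := by
      refine le_trans ?_ hn
      have : scalarUp.{u} 𝕜 (f (D.emb G x)) = (show ULift.{u} 𝕜 from a) + (show ULift.{u} 𝕜 from b) :=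
        e1.symm.trans hab
      have h' : ‖scalarUp.{u} 𝕜 (f (D.emb G x))‖ ≤ ‖a‖ + ‖b‖ := by
        rw [this]; exact norm_add_le _ _
      exact h'
    have e3 : ‖G.map T x‖ ≤ |c| * (σ ^ (1 - θ) * (σ * t) ^ θ) * ‖x‖ := by
      refine ((G.map T).le_opNorm x).trans ?_
      gcongr
      refine (hc T).trans ?_
      have : (0:ℝ) ≤ 1 - θ := by linarith
      gcongr
      exact le_abs_self c
    have e4 : σ ^ (1 - θ) * (σ * t) ^ θ = σ * t ^ θ := by
      rw [Real.mul_rpow hσ0.le ht.le, ← mul_assoc, ← Real.rpow_add hσ0]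
      simp
    rw [e4] at e3
    have e5 : σ ≤ ‖f (D.emb G x)‖ := RCLike.re_le_norm _
    have e6 : σ ≤ |K| * (|c| * (σ * t ^ θ) * ‖x‖) := by
      refine e5.trans (e2.trans ?_)
      gcongr
      exact le_abs_self K
    have e7 : σ ≤ σ * (|K| * |c| * (t ^ θ * ‖x‖)) := by
      refine e6.trans (le_of_eq (by ring))
    have e8 := mul_lt_mul_of_pos_left hx hσ0
    linarith
  refine ⟨|K| * |c|, by positivity, fun x t M ht hM => ?_⟩
  have hM0 : 0 < M := lt_of_le_of_lt (by positivity) hM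
  have hMk : ((M : ℝ) : 𝕜) ≠ 0 := by exact_mod_cast hM0.ne'
  obtain ⟨a, b, hab, ha, hb⟩ := key ((((M : ℝ) : 𝕜)⁻¹) • x) t ht (by
    rw [norm_smul, norm_inv, RCLike.norm_ofReal, abs_of_pos hM0]
    calc _ = M⁻¹ * (|K| * |c| * (t ^ θ * ‖x‖)) := by ring
      _ < M⁻¹ * M := by gcongr
      _ = 1 := inv_mul_cancel₀ hM0.ne')
  refine ⟨((M : ℝ) : 𝕜) • a, ((M : ℝ) : 𝕜) • b, ?_, ?_, ?_⟩
  · rw [map_smul, ← smul_add, ← hab, map_smul, smul_inv_smul₀ hMk]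
  · rw [norm_smul, RCLike.norm_ofReal, abs_of_pos hM0]
    nlinarith
  · rw [norm_smul, RCLike.norm_ofReal, abs_of_pos hM0]
    nlinarith

theorem InjectedCouple.exists_lift (D : InjectedCouple.{u} 𝕜) {G : InterpolationFunctor.{u} 𝕜}
    {θ : ℝ} (hG : G.HasExponent θ) (h0 : 0 ≤ θ) (h1 : θ ≤ 1):
    ∃ C : ℝ, 0 ≤ C ∧ ∀ b, ∃ x, D.emb G x = D.inj b ∧
      ∀ p q : ℝ, ‖D.inj b‖ ≤ p → ‖b‖ ≤ q → ‖x‖ ≤ C * (p ^ (1 - θ) * q ^ θ) := by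
  obtain ⟨c, hc⟩ := hG (scalarCouple 𝕜) D.toCouple
  obtain ⟨K, hK⟩ := G.inter_le (scalarCouple.{u} 𝕜)
  obtain ⟨e, he, hen⟩ := hK (scalarUp.{u} 𝕜 1) (scalarUp.{u} 𝕜 1) rfl
  refine ⟨|c| * ‖e‖, by positivity, fun b => ?_⟩
  let R : ULift.{u} 𝕜 →L[𝕜] 𝕜 :=
    (ContinuousLinearEquiv.ulift (R₁ := 𝕜) (M₁ := 𝕜)).toContinuousLinearMap
  let T : CoupleHom (scalarCouple.{u} 𝕜) D.toCouple :=
    { T₀ := R.smulRight (D.inj b)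
      T₁ := R.smulRight b
      agree := by
        intro r r' h
        have h' : r = r' := h
        subst h'
        change R r • D.inj b = D.inj (R r • b)
        rw [map_smul] }
  refine ⟨G.map T e, ?_, fun p q hp hq => ?_⟩
  · have := G.map_emb T e (scalarUp.{u} 𝕜 1) 0 (by rw [he]; simp)
    have h2 : T.T₀ (scalarUp.{u} 𝕜 1) = D.inj b := by
      change (1 : 𝕜) • D.inj b = _
      simp
    rw [h2, map_zero, map_zero, add_zero] at this
    exact this
  · have hR : ∀ r, ‖R r‖ = ‖r‖ := fun r => rfl
    have hT0 : ‖T.T₀‖ ≤ p := by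
      refine ContinuousLinearMap.opNorm_le_bound _ ((norm_nonneg _).trans hp) fun r => ?_
      change ‖R r • D.inj b‖ ≤ p * ‖R r‖
      rw [norm_smul, mul_comm]
      gcongr
    have hT1 : ‖T.T₁‖ ≤ q := by
      refine ContinuousLinearMap.opNorm_le_bound _ ((norm_nonneg _).trans hq) fun r => ?_
      change ‖R r • b‖ ≤ q * ‖R r‖
      rw [norm_smul, mul_comm]
      gcongr
    have : (0:ℝ) ≤ 1 - θ := by linarith
    have hq0 : 0 ≤ q := (norm_nonneg _).trans hq
    have hp0 : 0 ≤ p := (norm_nonneg _).trans hp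
    calc ‖G.map T e‖ ≤ ‖G.map T‖ * ‖e‖ := (G.map T).le_opNorm e
      _ ≤ (|c| * (p ^ (1 - θ) * q ^ θ)) * ‖e‖ := by
        gcongr
        refine (hc T).trans ?_
        gcongr
        exact le_abs_self c
      _ = _ := by ring


/-- The spaces of an interpolation scale are decreasing: an interpolation space of exponent `t` of
`E₁ ↪ E₀` embeds continuously into one of exponent `s < t`, even for two unrelated functors. -/
theorem InjectedCouple.exists_incl (D : InjectedCouple.{u} 𝕜) {G H : InterpolationFunctor.{u} 𝕜}
    {s t : ℝ} (hs : 0 ≤ s) (hst : s < t) (ht : t ≤ 1) (hG : G.HasExponent s)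
    (hH : H.HasExponent t) :
    ∃ i : H.obj D.toCouple →L[𝕜] G.obj D.toCouple, ∀ x, D.emb G (i x) = D.emb H x := by
  obtain ⟨C, hC0, hC⟩ := D.exists_decomp (hs.trans hst.le) ht hH
  obtain ⟨K, hK0, hK⟩ := D.exists_lift hG hs (hst.le.trans ht)
  obtain ⟨B, hB⟩ := D.emb_bound G
  -- the dyadic ratio
  set ρ : ℝ := (2:ℝ) ^ (s - t) with hρ
  have hρ0 : 0 < ρ := by positivity
  have hρ1 : ρ < 1 := Real.rpow_lt_one_of_one_lt_of_neg one_lt_two (by linarith)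
  set K' : ℝ := K * ((‖D.inj‖ + 1) ^ (1 - s) + (4 / (1 - ρ))) with hK'
  have main : ∀ x, ∃ y, D.emb G y = D.emb H x ∧ ‖y‖ ≤ K' * (C + 1) * ‖x‖ := by
    intro x
    by_cases hx : x = 0
    · exact ⟨0, by simp [hx], by simp [hx]⟩
    have hxn : 0 < ‖x‖ := norm_pos_iff.2 hx
    set M : ℝ := (C + 1) * ‖x‖ with hM
    have hM0 : 0 < M := by positivity
    set τ : ℕ → ℝ := fun n => ((2:ℝ) ^ n)⁻¹ with hτ
    have hτ0 : ∀ n, 0 < τ n := fun n => by positivity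
    have hτ1 : ∀ n, τ (n + 1) = τ n / 2 := fun n => by
      simp only [hτ, pow_succ]; field_simp
    have hdec : ∀ n, ∃ a b, D.emb H x = a + D.inj b ∧ ‖a‖ ≤ M * τ n ^ t ∧
        τ n * ‖b‖ ≤ M * τ n ^ t := fun n => by
      refine hC x (τ n) _ (hτ0 n) ?_
      have := Real.rpow_pos_of_pos (hτ0 n) t
      rw [hM]
      nlinarith [mul_pos this hxn]
    choose a b hab ha hb using hdec
    have hjd : ∀ n, D.inj (b (n + 1) - b n) = a n - a (n + 1) := fun n => by
      rw [map_sub]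
      have h1 := hab n
      rw [hab (n + 1)] at h1
      rw [sub_eq_sub_iff_add_eq_add, add_comm, h1]
    have hτle : ∀ n, τ (n + 1) ^ t ≤ τ n ^ t := fun n => by
      apply Real.rpow_le_rpow (hτ0 _).le _ (hs.trans hst.le)
      rw [hτ1]; linarith [hτ0 n]
    have hd0 : ∀ n, ‖D.inj (b (n + 1) - b n)‖ ≤ 4 * M * τ n ^ t := fun n => by
      rw [hjd]
      refine (norm_sub_le _ _).trans ?_
      have := Real.rpow_pos_of_pos (hτ0 n) t
      nlinarith [ha n, ha (n + 1), mul_le_mul_of_nonneg_left (hτle n) hM0.le]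
    have hd1 : ∀ n, ‖b (n + 1) - b n‖ ≤ 4 * M * (τ n ^ t / τ n) := fun n => by
      refine (norm_sub_le _ _).trans ?_
      rw [← mul_div_assoc, le_div_iff₀ (hτ0 n)]
      have h2 := hb (n + 1)
      rw [hτ1] at h2
      have h3 := mul_le_mul_of_nonneg_left (hτle n) hM0.le
      rw [hτ1] at h3
      have := mul_pos hM0 (Real.rpow_pos_of_pos (hτ0 n) t)
      nlinarith [hb n]
    choose z hz hzn using hK
    have hpow : ∀ n, (4 * M * τ n ^ t) ^ (1 - s) * (4 * M * (τ n ^ t / τ n)) ^ s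
        = 4 * M * ρ ^ n := fun n => by
      have hp : 0 < τ n ^ t := Real.rpow_pos_of_pos (hτ0 n) t
      have h4 : 0 < 4 * M * τ n ^ t := by positivity
      rw [← mul_div_assoc, Real.div_rpow h4.le (hτ0 n).le, ← mul_div_assoc, ← Real.rpow_add h4]
      have : (1 - s + s) = 1 := by ring
      rw [this, Real.rpow_one, mul_div_assoc, ← Real.rpow_sub (hτ0 n)]
      congr 1
      simp only [hτ, hρ]
      rw [Real.inv_rpow (by positivity), ← Real.rpow_neg (by positivity), ← Real.rpow_natCast,
        ← Real.rpow_natCast, ← Real.rpow_mul (by positivity), ← Real.rpow_mul (by positivity)]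
      congr 1
      ring
    have hzd : ∀ n, ‖z (b (n + 1) - b n)‖ ≤ K * (4 * M) * ρ ^ n := fun n => by
      refine (hzn _ _ _ (hd0 n) (hd1 n)).trans (le_of_eq ?_)
      rw [hpow]; ring
    have hgeo : HasSum (fun n => K * (4 * M) * ρ ^ n) (K * (4 * M) * (1 - ρ)⁻¹) :=
      (hasSum_geometric_of_lt_one hρ0.le hρ1).mul_left _
    have hsum : Summable fun n => z (b (n + 1) - b n) :=
      Summable.of_norm_bounded hgeo.summable hzd
    have hz0 : ‖z (b 0)‖ ≤ K * (M * (‖D.inj‖ + 1) ^ (1 - s)) := by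
      have h0 : ‖b 0‖ ≤ M := by simpa [hτ] using hb 0
      have h1 : ‖D.inj (b 0)‖ ≤ M * (‖D.inj‖ + 1) := by
        refine (D.inj.le_opNorm _).trans ?_
        nlinarith [norm_nonneg D.inj]
      refine (hzn _ _ _ h1 h0).trans (le_of_eq ?_)
      rw [Real.mul_rpow hM0.le (by positivity), mul_right_comm, ← Real.rpow_add hM0]
      simp
    refine ⟨z (b 0) + ∑' n, z (b (n + 1) - b n), ?_, ?_⟩
    · let e : G.obj D.toCouple →L[𝕜] D.E₀ := (D.emb G).mkContinuous B hB
      change e _ = _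
      have h1 : HasSum (fun n => D.inj (b (n + 1) - b n))
          (e (∑' n, z (b (n + 1) - b n))) := by
        have := hsum.hasSum.mapL e
        refine this.congr_fun ?_
        intro n
        exact (hz _).symm
      have h2 := h1.tendsto_sum_nat
      have h3 : ∀ N, ∑ n ∈ Finset.range N, D.inj (b (n + 1) - b n) = D.inj (b N) - D.inj (b 0) :=
        fun N => by
          simp_rw [map_sub]
          exact Finset.sum_range_sub (fun n => D.inj (b n)) N
      simp_rw [h3] at h2
      have h4 : Filter.Tendsto (fun N => a N) Filter.atTop (nhds 0) := by
        refine squeeze_zero_norm ha ?_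
        have : Filter.Tendsto τ Filter.atTop (nhds 0) :=
          tendsto_inv_atTop_zero.comp (tendsto_pow_atTop_atTop_of_one_lt one_lt_two)
        have h5 := (this.rpow_const (Or.inr (hs.trans hst.le) : (0:ℝ) ≠ 0 ∨ 0 ≤ t)).const_mul M
        rwa [Real.zero_rpow (by linarith), mul_zero] at h5
      have h5 : Filter.Tendsto (fun N => D.inj (b N) - D.inj (b 0)) Filter.atTop
          (nhds (D.emb H x - 0 - D.inj (b 0))) := by
        refine ((tendsto_const_nhds.sub h4).sub_const _).congr fun N => ?_
        rw [hab N]; abel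
      have h6 := tendsto_nhds_unique h2 h5
      rw [map_add, h6]
      have : e (z (b 0)) = D.inj (b 0) := hz _
      rw [this]; abel
    · refine (norm_add_le _ _).trans ?_
      have h1 := tsum_of_norm_bounded hgeo hzd
      refine (add_le_add hz0 h1).trans (le_of_eq ?_)
      rw [hK', hM]; ring
  choose y hy hyn using main
  have hinj := G.emb_inj D.toCouple
  let iL : H.obj D.toCouple →ₗ[𝕜] G.obj D.toCouple :=
    { toFun := y
      map_add' := fun p q => hinj (by
        change D.emb G _ = D.emb G _
        rw [map_add, hy, hy, hy, map_add])
      map_smul' := fun c p => hinj (by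
        change D.emb G _ = D.emb G _
        rw [RingHom.id_apply, map_smul, hy, hy, map_smul]) }
  exact ⟨iL.mkContinuous _ hyn, hy⟩

end aux

namespace InterpolationFunctor

/-- An admissible interpolation functor of exponent `θ`: it is of exponent `θ`, and `E₁` is dense in
the interpolation space whenever `E₁` is densely injected in `E₀`. -/
structure IsAdmissible {𝕜 : Type} [RCLike 𝕜] (G : InterpolationFunctor.{u} 𝕜) (θ : ℝ) : Prop where
  exponent : G.HasExponent θ
  dense : ∀ D : InjectedCouple.{u} 𝕜, DenseRange D.inj →
    Dense {x : G.obj D.toCouple | D.emb G x ∈ Set.range D.inj}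

/-- The functor `(X₀, X₁)_0 = X₀`. -/
def left (𝕜 : Type) [RCLike 𝕜] : InterpolationFunctor.{u} 𝕜 where
  obj X := X.X₀
  emb X := X.ι₀
  emb_inj X := X.inj₀
  inter_le X := ⟨1, fun a b _ => ⟨a, rfl, by simp⟩⟩
  le_sum X := ⟨1, fun x => ⟨x, 0, by simp, by simp⟩⟩
  map T := T.T₀
  map_emb {X Y} T x a b h := by
    have h1 : X.ι₀ (x - a) = X.ι₁ b := by
      rw [map_sub, sub_eq_iff_eq_add']
      exact h
    have h2 := T.agree _ _ h1
    rw [map_sub, map_sub, sub_eq_iff_eq_add'] at h2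
    exact h2

/-- The functor `(X₀, X₁)_1 = X₁`. -/
def right (𝕜 : Type) [RCLike 𝕜] : InterpolationFunctor.{u} 𝕜 where
  obj X := X.X₁
  emb X := X.ι₁
  emb_inj X := X.inj₁
  inter_le X := ⟨1, fun a b h => ⟨b, h.symm, by simp⟩⟩
  le_sum X := ⟨1, fun x => ⟨0, x, by simp, by simp⟩⟩
  map T := T.T₁
  map_emb {X Y} T x a b h := by
    have h1 : X.ι₀ a = X.ι₁ (x - b) := by
      rw [map_sub, eq_sub_iff_add_eq]
      exact h.symm
    have h2 := T.agree _ _ h1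
    rw [map_sub, map_sub, eq_sub_iff_add_eq] at h2
    exact h2.symm

theorem hasExponent_left (𝕜 : Type) [RCLike 𝕜] : (left.{u} 𝕜).HasExponent 0 :=
  fun _ _ => ⟨1, fun T => by
    change ‖T.T₀‖ ≤ _
    simp⟩

theorem hasExponent_right (𝕜 : Type) [RCLike 𝕜] : (right.{u} 𝕜).HasExponent 1 :=
  fun _ _ => ⟨1, fun T => by
    change ‖T.T₁‖ ≤ _
    simp⟩

end InterpolationFunctor

/-- A choice of an arbitrary admissible interpolation functor `(·,·)_θ` for each `θ ∈ (0,1)`. -/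
structure AdmissibleFamily (𝕜 : Type) [RCLike 𝕜] where
  functor : ℝ → InterpolationFunctor.{u} 𝕜
  admissible : ∀ θ, 0 < θ → θ < 1 → (functor θ).IsAdmissible θ

open Classical in
/-- The functor `(·,·)_θ` for `θ ∈ [0,1]`, with `(E₀,E₁)_0 = E₀` and `(E₀,E₁)_1 = E₁`. -/
noncomputable def AdmissibleFamily.ext {𝕜 : Type} [RCLike 𝕜] (I : AdmissibleFamily.{u} 𝕜)
    (θ : unitInterval) : InterpolationFunctor.{u} 𝕜 :=
  if θ = 0 then InterpolationFunctor.left 𝕜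
  else if θ = 1 then InterpolationFunctor.right 𝕜
  else I.functor θ

theorem AdmissibleFamily.hasExponent_ext {𝕜 : Type} [RCLike 𝕜] (I : AdmissibleFamily.{u} 𝕜)
    (θ : unitInterval) : (I.ext θ).HasExponent θ := by
  unfold AdmissibleFamily.ext
  split_ifs with h0 h1
  · subst h0; exact InterpolationFunctor.hasExponent_left 𝕜
  · subst h1; exact InterpolationFunctor.hasExponent_right 𝕜
  · exact (I.admissible θ (unitInterval.pos_iff_ne_zero.2 h0)
      (unitInterval.lt_one_iff_ne_one.2 h1)).exponent

namespace InjectedCouple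
variable {𝕜 : Type} [RCLike 𝕜]

/-- The interpolation space `E_θ = (E₀,E₁)_θ`. -/
noncomputable def space (D : InjectedCouple.{u} 𝕜) (I : AdmissibleFamily.{u} 𝕜)
    (θ : unitInterval) : Ban.{u} 𝕜 :=
  (I.ext θ).obj D.toCouple

/-- The embedding `E_θ ↪ E₀`. -/
noncomputable def toBase (D : InjectedCouple.{u} 𝕜) (I : AdmissibleFamily.{u} 𝕜)
    (θ : unitInterval) : D.space I θ →ₗ[𝕜] D.E₀ :=
  D.emb (I.ext θ)

theorem toBase_injective (D : InjectedCouple.{u} 𝕜) (I : AdmissibleFamily.{u} 𝕜)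
    (θ : unitInterval) : Function.Injective (D.toBase I θ) :=
  (I.ext θ).emb_inj D.toCouple

theorem exists_incl_space (D : InjectedCouple.{u} 𝕜) (I : AdmissibleFamily.{u} 𝕜)
    {s t : unitInterval} (h : s < t) :
    ∃ i : D.space I t →L[𝕜] D.space I s, ∀ x, D.toBase I s (i x) = D.toBase I t x :=
  D.exists_incl s.2.1 h t.2.2 (I.hasExponent_ext s) (I.hasExponent_ext t)

/-- The continuous inclusion `E_t ↪ E_s` for `0 ≤ s < t ≤ 1`, i.e. the unique map that is compatible
with the embeddings into `E₀`. -/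
noncomputable def incl (D : InjectedCouple.{u} 𝕜) (I : AdmissibleFamily.{u} 𝕜)
    {s t : unitInterval} (h : s < t) : D.space I t →L[𝕜] D.space I s :=
  Classical.choose (D.exists_incl_space I h)

theorem toBase_incl (D : InjectedCouple.{u} 𝕜) (I : AdmissibleFamily.{u} 𝕜)
    {s t : unitInterval} (h : s < t) (x : D.space I t) :
    D.toBase I s (D.incl I h x) = D.toBase I t x :=
  Classical.choose_spec (D.exists_incl_space I h) x

theorem incl_injective (D : InjectedCouple.{u} 𝕜) (I : AdmissibleFamily.{u} 𝕜)
    {s t : unitInterval} (h : s < t) : Function.Injective (D.incl I h) := fun x y hxy =>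
  D.toBase_injective I t (by rw [← D.toBase_incl I h x, ← D.toBase_incl I h y, hxy])

/-- The couple `E_t ↪ E_s` for `s < t`. -/
noncomputable def subcouple (D : InjectedCouple.{u} 𝕜) (I : AdmissibleFamily.{u} 𝕜)
    {s t : unitInterval} (h : s < t) : InjectedCouple.{u} 𝕜 where
  E₀ := D.space I s
  E₁ := D.space I t
  inj := D.incl I h
  injective := D.incl_injective I h

end InjectedCouple

section operators
variable {𝕜 : Type} [RCLike 𝕜] {E₀ E₁ : Type*} [NormedAddCommGroup E₀] [NormedSpace 𝕜 E₀]
  [NormedAddCommGroup E₁] [NormedSpace 𝕜 E₁]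

/-- The complexification of `z - A`, for a linear operator `A` in `E₀` with domain `j : E₁ ↪ E₀` and
`z = a + ib ∈ ℂ`: identifying `x + iy` with `(x, y)`,
`(z - A)(x + iy) = (a x - b y - A x) + i (b x + a y - A y)`.
For `𝕜 = ℝ` this is the usual complexification. For `𝕜 = ℂ` every pair is uniquely of the form
`(u, -iu) + (v, iv)`, and the operator becomes `(z - A) u` on the first summand and `(conj z - A) v`
on the second; so conditions below that are symmetric under `z ↦ conj z` are conditions on `z - A`
itself. -/
noncomputable def complexResolvent (j A : E₁ →L[𝕜] E₀) (z : ℂ) : E₁ × E₁ → E₀ × E₀ := fun p =>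
  ((z.re : 𝕜) • j p.1 - (z.im : 𝕜) • j p.2 - A p.1,
    (z.im : 𝕜) • j p.1 + (z.re : 𝕜) • j p.2 - A p.2)

/-- `A ∈ ℋ(E₁, E₀)`: the operator `A` in `E₀` with domain `j : E₁ ↪ E₀` generates a strongly
continuous analytic semigroup on `E₀`, i.e. it is densely defined and sectorial: for some `ω` and `κ`,
all `z - A` with `Re z ≥ ω` (in the complexification, if `𝕜 = ℝ`) are bijective from `E₁` onto `E₀`,
with `|z| ‖x‖_{E₀} + ‖x‖_{E₁} ≤ κ ‖(z - A) x‖_{E₀}`. -/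
structure IsAnalyticGenerator (j A : E₁ →L[𝕜] E₀) : Prop where
  injective : Function.Injective j
  dense : DenseRange j
  sectorial : ∃ ω κ : ℝ, ∀ z : ℂ, ω ≤ z.re →
    Function.Bijective (complexResolvent j A z) ∧
    ∀ p : E₁ × E₁, ‖z‖ * ‖(j p.1, j p.2)‖ + ‖p‖ ≤ κ * ‖complexResolvent j A z p‖

/-- `0` is a semi-simple eigenvalue of `A`: it is an eigenvalue, `rg A` is closed in `E₀`, and
`E₀ = ker A ⊕ rg A`. -/
structure IsSemisimpleEigenvalueZero (j A : E₁ →L[𝕜] E₀) : Prop where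
  eigenvalue : ∃ x, x ≠ 0 ∧ A x = 0
  closed : IsClosed (Set.range A)
  compl : IsCompl (A.toLinearMap.ker.map j.toLinearMap) A.toLinearMap.range

/-- `P` is the spectral projection of `A` corresponding to the spectral set `{0}`: a bounded
projection of `E₀` that commutes with `A`, whose range lies in the domain of `A`, such that the part of
`A` in `rg P` has no spectrum outside `{0}`, and `0` is not in the spectrum of the part of `A` in
`ker P`. -/
structure IsSpectralProjectionZero (j A : E₁ →L[𝕜] E₀) (P : E₀ →L[𝕜] E₀) : Prop where
  idem : ∀ x, P (P x) = P x
  range_domain : ∀ x, ∃ y, j y = P x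
  comm : ∀ x, ∃ y, j y = P (j x) ∧ A y = P (A x)
  spectrum_range : ∀ z : ℂ, z ≠ 0 → Set.BijOn (complexResolvent j A z)
    {p | P (j p.1) = j p.1 ∧ P (j p.2) = j p.2} {q | P q.1 = q.1 ∧ P q.2 = q.2}
  spectrum_ker : Set.BijOn A {x | P (j x) = 0} {y | P y = 0}

end operators

/-! Interpolation. Only two facts about the functors enter. An element of a space of exponent `t`
splits as `a + b` with `‖a‖` and `τ ‖b‖` of order `τ ^ t` (`exists_decomp`), and elements of `E₁`
satisfy `‖b‖_s ≤ C ‖b‖₀ ^ (1 - s) ‖b‖₁ ^ s` (`exists_lift`). A dyadic telescoping series combines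
them at the price of an arbitrarily small loss of exponent. Since the `θ i` are strictly ordered,
the loss is harmless: `exists_interpolation_bound` gives `‖x‖_s ≤ C ‖x‖_r ^ (1 - l) ‖x‖_t ^ l`
whenever `s < (1 - l) r + l t`, for unrelated functors. Compactness of the embeddings, one-sided
reiteration for the spaces `E_β` and the lower-order character of perturbations all follow.

Generation. At both levels `A_* - A(u_*)` factors boundedly through `F_{θ 3}`, which lies strictly
between the domain and the base space. Its size relative to `z - A(u_*)` is thus `O(|z| ^ (-(1 -
l)))`, and sectoriality survives (`IsAnalyticGenerator.add`).

Semi-simplicity. For large real `r` both `r - B₁` and `r - B₀` are invertible, and `B₁` is a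
restriction of `B₀`. Hence `B₀ x ∈ F_{θ 1}` forces `x ∈ F_{θ 5}`. So the two kernels coincide, and a
common element of the kernel and the range of `B₀` is already one for `B₁`, hence zero. As `F_{θ 4}
↪ F_{θ 0}` is compact, the Fredholm alternative turns this trivial intersection into a closed
complement (`isCompl_ker_range_of_isCompactOperator`). The projections onto the kernels along the
ranges are the spectral projections, and the resolvents bound the `F_{θ 5}` norm on the kernel
(`IsSemisimpleEigenvalueZero.extend`). -/

/-! ### Interpolation inequalities, one-sided reiteration and compact embeddings -/

namespace InjectedCouple
variable {𝕜 : Type} [RCLike 𝕜]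

/-- If `e : Y → E₀` satisfies the lifting estimate of exponent `s`, then an element of `E₀` whose
`K`-functional is `O(τ ^ t)` for some `t > s` lies in the range of `e`, with a norm estimate. -/
theorem exists_preimage_of_decomp (D : InjectedCouple.{u} 𝕜) {Y : Type*} [NormedAddCommGroup Y]
    [NormedSpace 𝕜 Y] [CompleteSpace Y] (e : Y →L[𝕜] D.E₀) {s t : ℝ} (hs : 0 ≤ s) (hst : s < t)
    {K : ℝ} (hK0 : 0 ≤ K) (hK : ∀ b, ∃ x, e x = D.inj b ∧
      ∀ p q : ℝ, ‖D.inj b‖ ≤ p → ‖b‖ ≤ q → ‖x‖ ≤ K * (p ^ (1 - s) * q ^ s)) :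
    ∃ K' : ℝ, 0 ≤ K' ∧ ∀ (x : D.E₀) (M : ℝ), 0 < M →
      (∀ τ : ℝ, 0 < τ → ∃ a b, x = a + D.inj b ∧ ‖a‖ ≤ M * τ ^ t ∧ τ * ‖b‖ ≤ M * τ ^ t) →
      ∃ y, e y = x ∧ ‖y‖ ≤ K' * M := by
  -- At scale `τ n = 2⁻ⁿ` the telescoping block has norm of order `τ n ^ t` in `E₀` and `τ n ^ (t -
  -- 1)` in `E₁`, so its lift has order `τ n ^ (t - s) = ρ ^ n`, which is summable because `s < t`.
  set ρ : ℝ := (2:ℝ) ^ (s - t) with hρ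
  have hρ0 : 0 < ρ := by positivity
  have hρ1 : ρ < 1 := Real.rpow_lt_one_of_one_lt_of_neg one_lt_two (by linarith)
  have hρ2 : 0 < 1 - ρ := by linarith
  -- The first summand pays for the lift of `b 0`, where `τ 0 = 1`; the second is the geometric
  -- series. The factor 4 covers both block norms: two terms `a`, and two terms `b` of which one is
  -- divided by `τ n / 2`.
  refine ⟨K * ((‖D.inj‖ + 1) ^ (1 - s) + (4 / (1 - ρ))), by positivity, fun x M hM0 hx => ?_⟩
  set τ : ℕ → ℝ := fun n => ((2:ℝ) ^ n)⁻¹ with hτ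
  have hτ0 : ∀ n, 0 < τ n := fun n => by positivity
  have hτ1 : ∀ n, τ (n + 1) = τ n / 2 := fun n => by
    simp only [hτ, pow_succ]; field_simp
  have hdec : ∀ n, ∃ a b, x = a + D.inj b ∧ ‖a‖ ≤ M * τ n ^ t ∧
      τ n * ‖b‖ ≤ M * τ n ^ t := fun n => hx (τ n) (hτ0 n)
  choose a b hab ha hb using hdec
  have hjd : ∀ n, D.inj (b (n + 1) - b n) = a n - a (n + 1) := fun n => by
    rw [map_sub]
    have h1 := hab n
    rw [hab (n + 1)] at h1
    rw [sub_eq_sub_iff_add_eq_add, add_comm, h1]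
  have hτle : ∀ n, τ (n + 1) ^ t ≤ τ n ^ t := fun n => by
    apply Real.rpow_le_rpow (hτ0 _).le _ (hs.trans hst.le)
    rw [hτ1]; linarith [hτ0 n]
  have hd0 : ∀ n, ‖D.inj (b (n + 1) - b n)‖ ≤ 4 * M * τ n ^ t := fun n => by
    rw [hjd]
    refine (norm_sub_le _ _).trans ?_
    have := Real.rpow_pos_of_pos (hτ0 n) t
    nlinarith [ha n, ha (n + 1), mul_le_mul_of_nonneg_left (hτle n) hM0.le]
  have hd1 : ∀ n, ‖b (n + 1) - b n‖ ≤ 4 * M * (τ n ^ t / τ n) := fun n => by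
    refine (norm_sub_le _ _).trans ?_
    rw [← mul_div_assoc, le_div_iff₀ (hτ0 n)]
    have h2 := hb (n + 1)
    rw [hτ1] at h2
    have h3 := mul_le_mul_of_nonneg_left (hτle n) hM0.le
    rw [hτ1] at h3
    have := mul_pos hM0 (Real.rpow_pos_of_pos (hτ0 n) t)
    nlinarith [hb n]
  choose z hz hzn using hK
  have hpow : ∀ n, (4 * M * τ n ^ t) ^ (1 - s) * (4 * M * (τ n ^ t / τ n)) ^ s
      = 4 * M * ρ ^ n := fun n => by
    have hp : 0 < τ n ^ t := Real.rpow_pos_of_pos (hτ0 n) t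
    have h4 : 0 < 4 * M * τ n ^ t := by positivity
    rw [← mul_div_assoc, Real.div_rpow h4.le (hτ0 n).le, ← mul_div_assoc, ← Real.rpow_add h4]
    have : (1 - s + s) = 1 := by ring
    rw [this, Real.rpow_one, mul_div_assoc, ← Real.rpow_sub (hτ0 n)]
    congr 1
    simp only [hτ, hρ]
    rw [Real.inv_rpow (by positivity), ← Real.rpow_neg (by positivity), ← Real.rpow_natCast,
      ← Real.rpow_natCast, ← Real.rpow_mul (by positivity), ← Real.rpow_mul (by positivity)]
    congr 1
    ring
  have hzd : ∀ n, ‖z (b (n + 1) - b n)‖ ≤ K * (4 * M) * ρ ^ n := fun n => by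
    refine (hzn _ _ _ (hd0 n) (hd1 n)).trans (le_of_eq ?_)
    rw [hpow]; ring
  have hgeo : HasSum (fun n => K * (4 * M) * ρ ^ n) (K * (4 * M) * (1 - ρ)⁻¹) :=
    (hasSum_geometric_of_lt_one hρ0.le hρ1).mul_left _
  have hsum : Summable fun n => z (b (n + 1) - b n) :=
    Summable.of_norm_bounded hgeo.summable hzd
  have hz0 : ‖z (b 0)‖ ≤ K * (M * (‖D.inj‖ + 1) ^ (1 - s)) := by
    have h0 : ‖b 0‖ ≤ M := by simpa [hτ] using hb 0
    have h1 : ‖D.inj (b 0)‖ ≤ M * (‖D.inj‖ + 1) := by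
      refine (D.inj.le_opNorm _).trans ?_
      nlinarith [norm_nonneg D.inj]
    refine (hzn _ _ _ h1 h0).trans (le_of_eq ?_)
    rw [Real.mul_rpow hM0.le (by positivity), mul_right_comm, ← Real.rpow_add hM0]
    simp
  -- The partial sums map to `D.inj (b N) = x - a N`, and `a N → 0` since `t > 0`.
  refine ⟨z (b 0) + ∑' n, z (b (n + 1) - b n), ?_, ?_⟩
  · have h1 : HasSum (fun n => D.inj (b (n + 1) - b n))
        (e (∑' n, z (b (n + 1) - b n))) := by
      have := hsum.hasSum.mapL e
      refine this.congr_fun ?_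
      intro n
      exact (hz _).symm
    have h2 := h1.tendsto_sum_nat
    have h3 : ∀ N, ∑ n ∈ Finset.range N, D.inj (b (n + 1) - b n) = D.inj (b N) - D.inj (b 0) :=
      fun N => by
        simp_rw [map_sub]
        exact Finset.sum_range_sub (fun n => D.inj (b n)) N
    simp_rw [h3] at h2
    have h4 : Filter.Tendsto (fun N => a N) Filter.atTop (nhds 0) := by
      refine squeeze_zero_norm ha ?_
      have : Filter.Tendsto τ Filter.atTop (nhds 0) :=
        tendsto_inv_atTop_zero.comp (tendsto_pow_atTop_atTop_of_one_lt one_lt_two)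
      have h5 := (this.rpow_const (Or.inr (hs.trans hst.le) : (0:ℝ) ≠ 0 ∨ 0 ≤ t)).const_mul M
      rwa [Real.zero_rpow (by linarith), mul_zero] at h5
    have h5 : Filter.Tendsto (fun N => D.inj (b N) - D.inj (b 0)) Filter.atTop
        (nhds (x - 0 - D.inj (b 0))) := by
      refine ((tendsto_const_nhds.sub h4).sub_const _).congr fun N => ?_
      rw [hab N]; abel
    have h6 := tendsto_nhds_unique h2 h5
    rw [map_add, h6, hz]
    abel
  · refine (norm_add_le _ _).trans ?_
    have h1 := tsum_of_norm_bounded hgeo hzd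
    refine (add_le_add hz0 h1).trans (le_of_eq ?_)
    ring

/-- The space `Y` need not come from a functor applied to `D`: for reiteration, `D` is the couple
`E_t ↪ E_r` while `Y = E_s` belongs to the original couple. -/
theorem exists_preimage_of_emb (D : InjectedCouple.{u} 𝕜) {H : InterpolationFunctor.{u} 𝕜}
    {Y : Type*} [NormedAddCommGroup Y] [NormedSpace 𝕜 Y] [CompleteSpace Y] (e : Y →L[𝕜] D.E₀)
    (he : Function.Injective e) {s t : ℝ} (hs : 0 ≤ s) (hst : s < t) (ht : t ≤ 1)
    (hH : H.HasExponent t) {K : ℝ} (hK0 : 0 ≤ K) (hK : ∀ b, ∃ x, e x = D.inj b ∧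
      ∀ p q : ℝ, ‖D.inj b‖ ≤ p → ‖b‖ ≤ q → ‖x‖ ≤ K * (p ^ (1 - s) * q ^ s)) :
    ∃ k : H.obj D.toCouple →L[𝕜] Y, ∀ x, e (k x) = D.emb H x := by
  obtain ⟨C, hC0, hC⟩ := D.exists_decomp (hs.trans hst.le) ht hH
  obtain ⟨K', hK'0, hK'⟩ := D.exists_preimage_of_decomp e hs hst hK0 hK
  have main : ∀ x, ∃ y, e y = D.emb H x ∧ ‖y‖ ≤ K' * (C + 1) * ‖x‖ := by
    intro x
    by_cases hx : x = 0
    · exact ⟨0, by simp [hx], by simp [hx]⟩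
    have hxn : 0 < ‖x‖ := norm_pos_iff.2 hx
    obtain ⟨y, hy, hyn⟩ := hK' (D.emb H x) ((C + 1) * ‖x‖) (by positivity) fun τ hτ =>
      hC x τ _ hτ (by
        have := mul_pos (Real.rpow_pos_of_pos hτ t) hxn
        nlinarith)
    exact ⟨y, hy, hyn.trans_eq (by ring)⟩
  choose y hy hyn using main
  let k : H.obj D.toCouple →ₗ[𝕜] Y :=
    { toFun := y
      map_add' := fun p q => he (by rw [map_add, hy, hy, hy, map_add])
      map_smul' := fun c p => he (by rw [RingHom.id_apply, map_smul, hy, hy, map_smul]) }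
  exact ⟨k.mkContinuous _ hyn, hy⟩

/-- Interpolation inequality between two unrelated functors and a third one of exponent strictly
below the convex combination of their exponents. -/
theorem exists_interpolation_bound (D : InjectedCouple.{u} 𝕜) {G H H' : InterpolationFunctor.{u} 𝕜}
    {r s t l : ℝ} (hr : r ∈ Set.Icc (0:ℝ) 1) (hs : s ∈ Set.Icc (0:ℝ) 1) (ht : t ∈ Set.Icc (0:ℝ) 1)
    (hl : l ∈ Set.Icc (0:ℝ) 1) (hlt : s < (1 - l) * r + l * t)
    (hG : G.HasExponent s) (hH : H.HasExponent r) (hH' : H'.HasExponent t) :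
    ∃ C : ℝ, 0 ≤ C ∧ ∀ x y, D.emb H x = D.emb H' y →
      ∃ z, D.emb G z = D.emb H' y ∧ ‖z‖ ≤ C * (‖x‖ ^ (1 - l) * ‖y‖ ^ l) := by
  obtain ⟨C, hC0, hC⟩ := D.exists_decomp hr.1 hr.2 hH
  obtain ⟨C', hC'0, hC'⟩ := D.exists_decomp ht.1 ht.2 hH'
  obtain ⟨K, hK0, hK⟩ := D.exists_lift hG hs.1 hs.2
  obtain ⟨B, hB⟩ := D.emb_bound G
  obtain ⟨K', hK'0, hK'⟩ := D.exists_preimage_of_decomp ((D.emb G).mkContinuous B hB) hs.1 hlt hK0 hK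
  -- The extra 1 provides the strict inequality that `exists_decomp` requires.
  refine ⟨K' * (C + C' + 1), by positivity, fun x y hxy => ?_⟩
  by_cases hy : y = 0
  · exact ⟨0, by simp [hy], by simp only [norm_zero]; positivity⟩
  have hx : x ≠ 0 := by
    rintro rfl
    rw [map_zero] at hxy
    exact hy (H'.emb_inj D.toCouple (hxy.symm.trans (map_zero _).symm))
  have hx0 : 0 < ‖x‖ := norm_pos_iff.2 hx
  have hy0 : 0 < ‖y‖ := norm_pos_iff.2 hy
  set N := ‖x‖ ^ (1 - l) * ‖y‖ ^ l with hN
  have hN0 : 0 < N := by positivity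
  have hl' : 0 ≤ 1 - l := by linarith [hl.2]
  obtain ⟨z, hz, hzn⟩ := hK' (D.emb H' y) ((C + C' + 1) * N) (by positivity) fun τ hτ => by
    set u := τ ^ r * ‖x‖ with hu
    set v := τ ^ t * ‖y‖ with hv
    have hu0 : 0 < u := by positivity
    have hv0 : 0 < v := by positivity
    have huv : u ^ (1 - l) * v ^ l = N * τ ^ ((1 - l) * r + l * t) := by
      rw [hu, hv, Real.mul_rpow (by positivity) hx0.le, Real.mul_rpow (by positivity) hy0.le,
        ← Real.rpow_mul hτ.le, ← Real.rpow_mul hτ.le, Real.rpow_add hτ, mul_comm r, mul_comm t, hN]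
      ring
    have hsplit : ∀ w : ℝ, 0 < w → w ^ (1 - l) * w ^ l = w := fun w hw => by
      rw [← Real.rpow_add hw]; simp
    rw [mul_assoc, ← huv]
    set m := u ^ (1 - l) * v ^ l with hm
    have hm0 : 0 < m := by positivity
    -- The same element of `E₀` can be decomposed through `x` at cost `u` or through `y` at cost
    -- `v`. The cheaper cost is at most the geometric mean `m`, which has order `τ ^ ((1 - l) r + l
    -- t)`.
    rcases le_total u v with h | h
    · have hum : u ≤ m := by
        calc u = u ^ (1 - l) * u ^ l := (hsplit u hu0).symm
          _ ≤ m := mul_le_mul_of_nonneg_left (Real.rpow_le_rpow hu0.le h hl.1) (by positivity)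
      obtain ⟨a, b, hab, h1, h2⟩ := hC x τ ((C + C' + 1) * m) hτ (by nlinarith)
      exact ⟨a, b, hxy ▸ hab, h1, h2⟩
    · have hvm : v ≤ m := by
        calc v = v ^ (1 - l) * v ^ l := (hsplit v hv0).symm
          _ ≤ m := mul_le_mul_of_nonneg_right (Real.rpow_le_rpow hv0.le h hl') (by positivity)
      exact hC' y τ ((C + C' + 1) * m) hτ (by nlinarith)
  exact ⟨z, hz, hzn.trans_eq (by ring)⟩

theorem incl_incl (D : InjectedCouple.{u} 𝕜) (I : AdmissibleFamily.{u} 𝕜) {r s t : unitInterval}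
    (hrs : r < s) (hst : s < t) (x : D.space I t) :
    D.incl I hrs (D.incl I hst x) = D.incl I (hrs.trans hst) x :=
  D.toBase_injective I r (by simp only [toBase_incl])

theorem norm_incl_le_interpolation (D : InjectedCouple.{u} 𝕜) (I : AdmissibleFamily.{u} 𝕜)
    {r s t : unitInterval} (hrs : r < s) (hst : s < t) {l : ℝ} (hl : l ∈ Set.Icc (0:ℝ) 1)
    (hlt : (s : ℝ) < (1 - l) * r + l * t) :
    ∃ C : ℝ, 0 ≤ C ∧ ∀ x : D.space I t,
      ‖D.incl I hst x‖ ≤ C * (‖D.incl I (hrs.trans hst) x‖ ^ (1 - l) * ‖x‖ ^ l) := by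
  obtain ⟨C, hC0, hC⟩ := D.exists_interpolation_bound r.2 s.2 t.2 hl hlt
    (I.hasExponent_ext s) (I.hasExponent_ext r) (I.hasExponent_ext t)
  refine ⟨C, hC0, fun x => ?_⟩
  obtain ⟨z, hz, hzn⟩ := hC (D.incl I (hrs.trans hst) x) x (D.toBase_incl I _ x)
  have : z = D.incl I hst x :=
    D.toBase_injective I s (hz.trans (D.toBase_incl I hst x).symm)
  exact this ▸ hzn

/-- One-sided reiteration: an interpolation space of exponent `β` of the couple `E_t ↪ E_r` embeds
into `E_s` when `s < (1 - β) r + β t`. -/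
theorem exists_subcouple_incl (D : InjectedCouple.{u} 𝕜) (I J : AdmissibleFamily.{u} 𝕜)
    {r s t : unitInterval} (hrs : r < s) (hst : s < t) {β : unitInterval}
    (hβ : (s : ℝ) < (1 - (β : ℝ)) * r + β * t) :
    ∃ k : (D.subcouple I (hrs.trans hst)).space J β →L[𝕜] D.space I s,
      ∀ x, D.incl I hrs (k x) = (D.subcouple I (hrs.trans hst)).toBase J β x := by
  have hrs' : (r : ℝ) < s := hrs
  have hst' : (s : ℝ) < t := hst
  have hrt' : 0 < (t : ℝ) - r := by linarith
  set m : ℝ := (s - r) / (t - r) with hm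
  have hm0 : 0 < m := div_pos (by linarith) hrt'
  have hmeq : m * (t - r) = s - r := div_mul_cancel₀ _ hrt'.ne'
  have hmβ : m < β := by
    rw [hm, div_lt_iff₀ hrt']
    linarith
  -- Here `m` is the relative position of `s` in `[r, t]`. Both gaps in `m < l < β` are used: the
  -- first for the interpolation inequality, the second for summing the dyadic series in the
  -- subcouple.
  set l : ℝ := (m + β) / 2 with hl
  have hlβ : l < β := by rw [hl]; linarith
  have hml : m < l := by rw [hl]; linarith
  have hl0 : 0 ≤ l := by linarith
  obtain ⟨C, hC0, hC⟩ := D.norm_incl_le_interpolation I hrs hst (l := l)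
    ⟨hl0, hlβ.le.trans β.2.2⟩ (by nlinarith)
  refine (D.subcouple I (hrs.trans hst)).exists_preimage_of_emb (H := J.ext β) (D.incl I hrs)
    (D.incl_injective I hrs) hl0 hlβ β.2.2 (J.hasExponent_ext β) hC0 fun b =>
    ⟨D.incl I hst b, D.incl_incl I hrs hst b, fun p q hp hq => (hC b).trans ?_⟩
  have hp0 : 0 ≤ p := (norm_nonneg _).trans hp
  exact mul_le_mul_of_nonneg_left (mul_le_mul
    (Real.rpow_le_rpow (norm_nonneg _) hp (by linarith [β.2.2]))
    (Real.rpow_le_rpow (norm_nonneg _) hq hl0) (Real.rpow_nonneg (norm_nonneg _) _)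
    (Real.rpow_nonneg hp0 _)) hC0

/-- The embedding `E_t ↪ E₀` is compact for `t > 0` if `E₁ ↪ E₀` is. -/
theorem totallyBounded_toBase_image (D : InjectedCouple.{u} 𝕜) (hD : IsCompactOperator D.inj)
    (I : AdmissibleFamily.{u} 𝕜) {t : unitInterval} (ht : 0 < (t : ℝ)) :
    TotallyBounded (D.toBase I t '' Metric.closedBall 0 1) := by
  obtain ⟨C, hC0, hC⟩ := D.exists_decomp t.2.1 t.2.2 (I.hasExponent_ext t)
  rw [Metric.totallyBounded_iff]
  intro ε hε
  have hlim : Filter.Tendsto (fun τ : ℝ => (C + 1) * τ ^ (t : ℝ)) (nhds 0) (nhds 0) := by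
    have := ((Real.continuousAt_rpow_const 0 (t : ℝ) (Or.inr t.2.1)).tendsto).const_mul (C + 1)
    rwa [Real.zero_rpow ht.ne', mul_zero] at this
  obtain ⟨δ, hδ, hδε⟩ := Metric.eventually_nhds_iff.1 (hlim.eventually_lt_const (half_pos hε))
  set τ := δ / 2 with hτ
  have hτ0 : 0 < τ := by positivity
  have hτε : (C + 1) * τ ^ (t : ℝ) < ε / 2 := hδε (by
    rw [Real.dist_eq, sub_zero, abs_of_pos hτ0, hτ]; linarith)
  have hpos := Real.rpow_pos_of_pos hτ0 (t : ℝ)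
  set R := (C + 1) * τ ^ (t : ℝ) / τ with hR
  -- With `τ` fixed, the part `a` is smaller than `ε / 2` and the part `b` stays in a fixed ball of
  -- `E₁`, whose image is precompact. A net for that image therefore serves all `x`.
  have hK : TotallyBounded (D.inj '' Metric.closedBall 0 R) :=
    (IsCompactOperator.isCompact_closure_image_closedBall (f := D.inj.toLinearMap) hD R).totallyBounded.subset
      subset_closure
  obtain ⟨S, hS, hSR⟩ := Metric.totallyBounded_iff.1 hK (ε / 2) (half_pos hε)
  refine ⟨S, hS, ?_⟩
  rintro _ ⟨x, hx, rfl⟩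
  have hx1 : ‖x‖ ≤ 1 := by simpa using hx
  obtain ⟨a, b, hab, ha, hb⟩ := hC x τ ((C + 1) * τ ^ (t : ℝ)) hτ0 (by
    have h1 : C * (τ ^ (t : ℝ) * ‖x‖) ≤ C * (τ ^ (t : ℝ) * 1) :=
      mul_le_mul_of_nonneg_left (mul_le_mul_of_nonneg_left hx1 hpos.le) hC0
    exact h1.trans_lt (by linarith))
  have hbR : ‖b‖ ≤ R := by rw [hR, le_div_iff₀ hτ0]; linarith
  obtain ⟨y, hy, hby⟩ := Set.mem_iUnion₂.1 (hSR ⟨b, by simpa using hbR, rfl⟩)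
  refine Set.mem_iUnion₂.2 ⟨y, hy, ?_⟩
  rw [Metric.mem_ball, dist_eq_norm] at hby ⊢
  have hab' : D.toBase I t x = a + D.inj b := hab
  calc ‖D.toBase I t x - y‖ = ‖a + (D.inj b - y)‖ := by rw [hab', add_sub_assoc]
    _ ≤ ‖a‖ + ‖D.inj b - y‖ := norm_add_le _ _
    _ < ε := by linarith

theorem isCompactOperator_incl (D : InjectedCouple.{u} 𝕜) (hD : IsCompactOperator D.inj)
    (I : AdmissibleFamily.{u} 𝕜) {s t : unitInterval} (hst : s < t) :
    IsCompactOperator (D.incl I hst) := by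
  have hst' : (s : ℝ) < t := hst
  have ht0 : (0:ℝ) < t := lt_of_le_of_lt s.2.1 hst'
  -- The midpoint of `s / t` and 1 gives `s < l t` with `1 - l > 0`, so smallness in `E₀` of
  -- elements bounded in `E_t` implies smallness in `E_s`.
  set l : ℝ := (s / t + 1) / 2 with hl
  have hdiv : (s : ℝ) / t < 1 := (div_lt_one ht0).2 hst'
  have hdiv0 : 0 ≤ (s : ℝ) / t := div_nonneg s.2.1 ht0.le
  have hl1 : l < 1 := by rw [hl]; linarith
  have hl0 : 0 ≤ l := by rw [hl]; linarith
  have hslt : (s : ℝ) < (1 - l) * 0 + l * t := by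
    rw [mul_zero, zero_add, ← div_lt_iff₀ ht0, hl]
    linarith
  obtain ⟨C, hC0, hC⟩ := D.exists_interpolation_bound (H := InterpolationFunctor.left 𝕜)
    ⟨le_rfl, zero_le_one⟩ s.2 t.2 ⟨hl0, hl1.le⟩ hslt
    (I.hasExponent_ext s) (InterpolationFunctor.hasExponent_left 𝕜) (I.hasExponent_ext t)
  have hbound : ∀ x : D.space I t,
      ‖D.incl I hst x‖ ≤ C * (‖D.toBase I t x‖ ^ (1 - l) * ‖x‖ ^ l) := fun x => by
    obtain ⟨z, hz, hzn⟩ := hC (D.toBase I t x) x rfl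
    have : z = D.incl I hst x :=
      D.toBase_injective I s (hz.trans (D.toBase_incl I hst x).symm)
    exact this ▸ hzn
  refine (isCompactOperator_iff_isCompact_closure_image_closedBall
    (D.incl I hst).toLinearMap zero_lt_one).2 ?_
  refine TotallyBounded.isCompact_of_isClosed (TotallyBounded.closure ?_) isClosed_closure
  rw [Metric.totallyBounded_iff]
  intro ε hε
  have hlim : Filter.Tendsto (fun δ : ℝ => C * (δ ^ (1 - l) * 2 ^ l)) (nhds 0) (nhds 0) := by
    have := (((Real.continuousAt_rpow_const 0 (1 - l)
      (Or.inr (by linarith))).tendsto).mul_const ((2:ℝ) ^ l)).const_mul C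
    rwa [Real.zero_rpow (by linarith), zero_mul, mul_zero] at this
  obtain ⟨δ, hδ, hδε⟩ := Metric.eventually_nhds_iff.1 (hlim.eventually_lt_const hε)
  -- The centres are taken inside the image of the unit ball, so that they lift to `E_t` and
  -- differences `x - y` have norm at most 2 there.
  obtain ⟨S, hSsub, hS, hcov⟩ := totallyBounded_iff_subset.1
    (D.totallyBounded_toBase_image hD I ht0) _ (Metric.dist_mem_uniformity hδ)
  obtain ⟨S', hS'sub, hS', rfl⟩ := hS.exists_subset_finite_image_eq hSsub
  refine ⟨D.incl I hst '' S', hS'.image _, ?_⟩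
  rintro _ ⟨x, hx, rfl⟩
  obtain ⟨_, ⟨y, hy, rfl⟩, hxy⟩ := Set.mem_iUnion₂.1 (hcov ⟨x, hx, rfl⟩)
  refine Set.mem_iUnion₂.2 ⟨_, ⟨y, hy, rfl⟩, ?_⟩
  have hx1 : ‖x‖ ≤ 1 := by simpa using hx
  have hy1 : ‖y‖ ≤ 1 := by simpa using hS'sub hy
  have hxy2 : ‖x - y‖ ≤ 2 := (norm_sub_le _ _).trans (by linarith)
  have hxyδ : ‖D.toBase I t (x - y)‖ < δ := by
    rw [map_sub, ← dist_eq_norm]; exact hxy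
  rw [Metric.mem_ball, dist_eq_norm]
  change ‖D.incl I hst x - D.incl I hst y‖ < ε
  rw [← map_sub]
  calc ‖D.incl I hst (x - y)‖
      ≤ C * (‖D.toBase I t (x - y)‖ ^ (1 - l) * ‖x - y‖ ^ l) := hbound _
    _ ≤ C * (‖D.toBase I t (x - y)‖ ^ (1 - l) * 2 ^ l) :=
      mul_le_mul_of_nonneg_left (mul_le_mul_of_nonneg_left
        (Real.rpow_le_rpow (norm_nonneg _) hxy2 hl0) (by positivity)) hC0
    _ < ε := hδε (by rwa [Real.dist_eq, sub_zero, abs_of_nonneg (norm_nonneg _)])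

end InjectedCouple

/-! ### Lower-order perturbations of analytic generators -/

section perturbation
variable {𝕜 : Type} [RCLike 𝕜]

/-- Factor `L - Q = (1 - Q L⁻¹) L` and use the Neumann series. The hypothesis bounds `Q L⁻¹`
directly, so continuity of `L⁻¹` is not needed. -/
theorem ContinuousLinearMap.bijective_sub_of_norm_le_half {E F : Type*} [NormedAddCommGroup E]
    [NormedSpace 𝕜 E] [NormedAddCommGroup F] [NormedSpace 𝕜 F] [CompleteSpace F] (L Q : E →L[𝕜] F)
    (hL : Function.Bijective L) (hQ : ∀ x, ‖Q x‖ ≤ 1 / 2 * ‖L x‖) :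
    Function.Bijective (L - Q) := by
  let e : E ≃ₗ[𝕜] F := LinearEquiv.ofBijective L.toLinearMap hL
  have he : ∀ y, L (e.symm y) = y := fun y => e.apply_symm_apply y
  let S : F →L[𝕜] F := (Q.toLinearMap.comp e.symm.toLinearMap).mkContinuous (1 / 2) fun y => by
    have := hQ (e.symm y)
    rwa [he] at this
  have hS : ‖S‖ < 1 := lt_of_le_of_lt (LinearMap.mkContinuous_norm_le _ (by norm_num) _)
    (by norm_num)
  have h1 : Function.Bijective (1 - S : F →L[𝕜] F) :=
    ContinuousLinearMap.isUnit_iff_bijective.1 (isUnit_one_sub_of_norm_lt_one hS)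
  have h2 : ⇑(L - Q) = (1 - S : F →L[𝕜] F) ∘ L := by
    funext x
    have h3 : S (L x) = Q x := congrArg Q (e.symm_apply_apply x)
    simp [h3]
  rw [h2]
  exact h1.comp hL

variable {E₀ E₁ : Type*} [NormedAddCommGroup E₀] [NormedSpace 𝕜 E₀]
  [NormedAddCommGroup E₁] [NormedSpace 𝕜 E₁]

/-- `complexResolvent` as a continuous linear map. -/
noncomputable def complexResolventL (j A : E₁ →L[𝕜] E₀) (z : ℂ) : E₁ × E₁ →L[𝕜] E₀ × E₀ :=
  (((z.re : 𝕜) • j.comp (ContinuousLinearMap.fst 𝕜 E₁ E₁) -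
      (z.im : 𝕜) • j.comp (ContinuousLinearMap.snd 𝕜 E₁ E₁) -
      A.comp (ContinuousLinearMap.fst 𝕜 E₁ E₁)).prod
    ((z.im : 𝕜) • j.comp (ContinuousLinearMap.fst 𝕜 E₁ E₁) +
      (z.re : 𝕜) • j.comp (ContinuousLinearMap.snd 𝕜 E₁ E₁) -
      A.comp (ContinuousLinearMap.snd 𝕜 E₁ E₁)))

theorem coe_complexResolventL (j A : E₁ →L[𝕜] E₀) (z : ℂ) :
    ⇑(complexResolventL j A z) = complexResolvent j A z := rfl

/-- Perturbations of lower order, in the sense of an interpolation inequality, preserve the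
generation of analytic semigroups. -/
theorem IsAnalyticGenerator.add [CompleteSpace E₀] {j A P : E₁ →L[𝕜] E₀}
    (h : IsAnalyticGenerator j A) {C l : ℝ} (hl0 : 0 ≤ l) (hl1 : l < 1)
    (hP : ∀ x, ‖P x‖ ≤ C * (‖j x‖ ^ (1 - l) * ‖x‖ ^ l)) : IsAnalyticGenerator j (A + P) := by
  refine ⟨h.injective, h.dense, ?_⟩
  obtain ⟨ω, κ, hκ⟩ := h.sectorial
  set k := max κ 1 with hk
  have hk0 : 0 < k := lt_of_lt_of_le one_pos (le_max_right _ _)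
  have hlim : Filter.Tendsto (fun x : ℝ => |C| * k * x ^ (-(1 - l))) Filter.atTop (nhds 0) := by
    have := (tendsto_rpow_neg_atTop (y := 1 - l) (by linarith)).const_mul (|C| * k)
    rwa [mul_zero] at this
  obtain ⟨ω₁, hω₁⟩ := Filter.eventually_atTop.1 (hlim.eventually_lt_const (one_half_pos (α := ℝ)))
  -- Beyond `ω₁` the perturbation is at most half of `z - A`, which costs a factor 2 in the
  -- resolvent estimate; the bound 1 keeps `‖z‖` positive.
  refine ⟨max ω (max ω₁ 1), 2 * k, fun z hz => ?_⟩
  obtain ⟨hz0, hz'⟩ := max_le_iff.1 hz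
  obtain ⟨hz1, hz2⟩ := max_le_iff.1 hz'
  have hzre : z.re ≤ ‖z‖ := Complex.re_le_norm z
  have hzpos : 0 < ‖z‖ := by linarith
  obtain ⟨hbij, hest⟩ := hκ z hz0
  have hest' : ∀ p : E₁ × E₁,
      ‖z‖ * ‖(j p.1, j p.2)‖ + ‖p‖ ≤ k * ‖complexResolvent j A z p‖ := fun p =>
    (hest p).trans (mul_le_mul_of_nonneg_right (le_max_left _ _) (norm_nonneg _))
  -- The resolvent estimate gives `‖j x‖ ≤ k n / ‖z‖` and `‖x‖ ≤ k n`; interpolating them gains the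
  -- factor `‖z‖ ^ (-(1 - l))`, which tends to 0.
  have hcomp : ∀ (p : E₁ × E₁) (x : E₁), ‖j x‖ ≤ ‖(j p.1, j p.2)‖ → ‖x‖ ≤ ‖p‖ →
      ‖P x‖ ≤ 1 / 2 * ‖complexResolvent j A z p‖ := fun p x hjx hx => by
    set n := ‖complexResolvent j A z p‖ with hn
    have hn0 : 0 ≤ n := norm_nonneg _
    have h1 : ‖j x‖ ≤ k * n / ‖z‖ := by
      rw [le_div_iff₀ hzpos]
      nlinarith [hest' p, norm_nonneg p]
    have h2 : ‖x‖ ≤ k * n := by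
      nlinarith [hest' p, norm_nonneg (j p.1, j p.2)]
    have hkn : 0 ≤ k * n := by positivity
    calc ‖P x‖ ≤ C * (‖j x‖ ^ (1 - l) * ‖x‖ ^ l) := hP x
      _ ≤ |C| * (‖j x‖ ^ (1 - l) * ‖x‖ ^ l) :=
        mul_le_mul_of_nonneg_right (le_abs_self C) (by positivity)
      _ ≤ |C| * ((k * n / ‖z‖) ^ (1 - l) * (k * n) ^ l) :=
        mul_le_mul_of_nonneg_left (mul_le_mul
          (Real.rpow_le_rpow (norm_nonneg _) h1 (by linarith))
          (Real.rpow_le_rpow (norm_nonneg _) h2 hl0) (by positivity) (by positivity))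
          (abs_nonneg _)
      _ = |C| * k * ‖z‖ ^ (-(1 - l)) * n := by
        have hsplit : (k * n) ^ (1 - l) * (k * n) ^ l = k * n := by
          rw [← Real.rpow_add_of_nonneg hkn (by linarith) hl0]; simp
        rw [Real.div_rpow hkn hzpos.le, Real.rpow_neg hzpos.le, div_eq_mul_inv, mul_right_comm,
          hsplit]
        ring
      _ ≤ 1 / 2 * n := mul_le_mul_of_nonneg_right (hω₁ _ (hz1.trans hzre)).le hn0
  let Q : E₁ × E₁ →L[𝕜] E₀ × E₀ := P.prodMap P
  have hQ : ∀ p, ‖Q p‖ ≤ 1 / 2 * ‖complexResolventL j A z p‖ := fun p =>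
    max_le (hcomp p p.1 (le_max_left _ _) (le_max_left _ _))
      (hcomp p p.2 (le_max_right _ _) (le_max_right _ _))
  have hsub : complexResolventL j A z - Q = complexResolventL j (A + P) z := by
    ext p <;> simp [complexResolventL, Q] <;> abel
  have hsub' : ∀ p, complexResolventL j (A + P) z p = complexResolventL j A z p - Q p := fun p => by
    rw [← hsub]; rfl
  refine ⟨?_, fun p => (hest' p).trans ?_⟩
  · rw [← coe_complexResolventL, ← hsub]
    exact ContinuousLinearMap.bijective_sub_of_norm_le_half _ _ hbij hQ
  · rw [← coe_complexResolventL, ← coe_complexResolventL]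
    have h1 := norm_sub_norm_le (complexResolventL j A z p) (Q p)
    rw [← hsub'] at h1
    nlinarith [hQ p]

/-- For real `z` the complexification decouples into two copies of `r j - A`, so bijectivity
descends to one copy and the open mapping theorem gives a bounded inverse. -/
theorem IsAnalyticGenerator.exists_resolvent [CompleteSpace E₀] [CompleteSpace E₁]
    {j A : E₁ →L[𝕜] E₀} (h : IsAnalyticGenerator j A) :
    ∃ ω : ℝ, ∀ r : ℝ, ω ≤ r → ∃ e : E₁ ≃L[𝕜] E₀, ∀ x, e x = (r : 𝕜) • j x - A x := by
  obtain ⟨ω, κ, hκ⟩ := h.sectorial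
  refine ⟨ω, fun r hr => ?_⟩
  obtain ⟨⟨hinj, hsurj⟩, -⟩ := hκ (r : ℂ) (by simpa using hr)
  have hz : ∀ p : E₁ × E₁, complexResolvent j A (r : ℂ) p =
      ((r : 𝕜) • j p.1 - A p.1, (r : 𝕜) • j p.2 - A p.2) := fun p => by
    simp [complexResolvent]
  let L : E₁ →L[𝕜] E₀ := (r : 𝕜) • j - A
  have hLinj : Function.Injective L := fun x y hxy => by
    have hxy' : (r : 𝕜) • j x - A x = (r : 𝕜) • j y - A y := hxy
    have : ((x, 0) : E₁ × E₁) = (y, 0) := hinj (by rw [hz, hz]; simp [hxy'])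
    exact congrArg Prod.fst this
  have hLsurj : Function.Surjective L := fun y => by
    obtain ⟨p, hp⟩ := hsurj (y, 0)
    rw [hz] at hp
    exact ⟨p.1, congrArg Prod.fst hp⟩
  exact ⟨ContinuousLinearEquiv.ofBijective L (LinearMap.ker_eq_bot.2 hLinj)
    (LinearMap.range_eq_top.2 hLsurj), fun x => rfl⟩

end perturbation

/-! ### Semi-simple zero eigenvalue, kernel projection and compact resolvent -/

section semisimple
variable {𝕜 : Type} [RCLike 𝕜] {E₀ E₁ : Type*} [NormedAddCommGroup E₀] [NormedSpace 𝕜 E₀]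
  [NormedAddCommGroup E₁] [NormedSpace 𝕜 E₁] {j A : E₁ →L[𝕜] E₀}

/-- On the kernel of `A` the map `e` acts as `r j`. The kernel thus becomes the fixed space of the
bounded operator `r j e⁻¹` on `E₀`, which yields its closedness and, when `j` is compact, its finite
dimension. -/
theorem mem_map_ker_iff_resolvent {r : 𝕜} {e : E₁ ≃L[𝕜] E₀} (he : ∀ x, e x = r • j x - A x)
    (y : E₀) : y ∈ A.toLinearMap.ker.map j.toLinearMap ↔ r • j (e.symm y) = y := by
  constructor
  · rintro ⟨x, hx, rfl⟩
    have hx' : A x = 0 := hx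
    have : e x = r • j x := by rw [he, hx', sub_zero]
    change r • j (e.symm (j x)) = j x
    rw [← map_smul, ← map_smul, ← this, e.symm_apply_apply]
  · intro h
    have h1 := he (e.symm y)
    rw [e.apply_symm_apply, h] at h1
    have h2 : A (e.symm y) = 0 := by
      rw [eq_comm, sub_eq_self] at h1; exact h1
    exact ⟨r • e.symm y, by simp [h2], by simpa using h⟩

theorem isClosed_map_ker {r : 𝕜} {e : E₁ ≃L[𝕜] E₀} (he : ∀ x, e x = r • j x - A x) :
    IsClosed (A.toLinearMap.ker.map j.toLinearMap : Set E₀) := by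
  have : (A.toLinearMap.ker.map j.toLinearMap : Set E₀) = {y | r • j (e.symm y) = y} :=
    Set.ext fun y => mem_map_ker_iff_resolvent he y
  rw [this]
  exact isClosed_eq (by fun_prop) continuous_id

/-- `P` is the projection onto the kernel of `A` along the range of `A`. -/
structure IsKernelProjection (j A : E₁ →L[𝕜] E₀) (P : E₀ →L[𝕜] E₀) : Prop where
  apply_ker : ∀ x, A x = 0 → P (j x) = j x
  apply_range : ∀ x, P (A x) = 0
  range_le : ∀ y, ∃ x, A x = 0 ∧ j x = P y
  ker_le : ∀ y, P y = 0 → ∃ x, A x = y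

/-- Kernel and range are complementary and both closed in the Banach space `E₀`, so the algebraic
projection is bounded. -/
theorem IsSemisimpleEigenvalueZero.exists_isKernelProjection [CompleteSpace E₀]
    (h : IsSemisimpleEigenvalueZero j A) {r : 𝕜} {e : E₁ ≃L[𝕜] E₀}
    (he : ∀ x, e x = r • j x - A x) : ∃ P, IsKernelProjection j A P := by
  have hcl : IsClosed (A.toLinearMap.range : Set E₀) := h.closed
  have htop : Submodule.IsTopCompl (A.toLinearMap.ker.map j.toLinearMap) A.toLinearMap.range :=
    (Submodule.isTopCompl_iff_isCompl_isClosed).2 ⟨h.compl, isClosed_map_ker he, hcl⟩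
  refine ⟨Submodule.projectionL _ _ htop, ?_, ?_, ?_, ?_⟩
  · intro x hx
    exact Submodule.projection_apply_of_mem_left h.compl ⟨x, hx, rfl⟩
  · intro x
    exact (Submodule.projection_apply_eq_zero_iff h.compl).2 ⟨x, rfl⟩
  · intro y
    obtain ⟨x, hx, hxy⟩ := Submodule.projection_apply_mem h.compl y
    exact ⟨x, hx, hxy⟩
  · intro y hy
    obtain ⟨x, hx⟩ := (Submodule.projection_apply_eq_zero_iff h.compl).1 hy
    exact ⟨x, hx⟩

theorem IsKernelProjection.range_iff {P : E₀ →L[𝕜] E₀} (hP : IsKernelProjection j A P) (y : E₀) :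
    (∃ v, P v = y) ↔ ∃ x, A x = 0 ∧ j x = y := by
  constructor
  · rintro ⟨v, rfl⟩; exact hP.range_le v
  · rintro ⟨x, hx, rfl⟩; exact ⟨_, hP.apply_ker x hx⟩

/-- On `rg P` the operator `A` vanishes, so `z - A` is multiplication by `z`, invertible for `z ≠
0`. On `ker P = rg A`, removing kernel components makes `A` bijective. -/
theorem IsKernelProjection.isSpectralProjectionZero {P : E₀ →L[𝕜] E₀}
    (hP : IsKernelProjection j A P) (hj : Function.Injective j) :
    IsSpectralProjectionZero j A P := by
  have hker : ∀ x, P (j x) = j x → A x = 0 := fun x hx => by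
    obtain ⟨y, hy, hyx⟩ := hP.range_le (j x)
    rwa [← hj (hyx.trans hx)]
  have hidem : ∀ x, P (P x) = P x := fun x => by
    obtain ⟨y, hy, hyx⟩ := hP.range_le x
    rw [← hyx, hP.apply_ker y hy]
  have hz' : ∀ {z : ℂ}, z ≠ 0 → (z.re : 𝕜) * z.re + (z.im : 𝕜) * z.im ≠ 0 := fun {z} hz => by
    rw [← Complex.normSq_pos, Complex.normSq_apply] at hz
    exact_mod_cast hz.ne'
  refine ⟨hidem, fun x => ?_, fun x => ?_, fun z hz => ⟨?_, ?_, ?_⟩, ?_, ?_, ?_⟩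
  · obtain ⟨y, -, hyx⟩ := hP.range_le x
    exact ⟨y, hyx⟩
  · obtain ⟨y, hy, hyx⟩ := hP.range_le (j x)
    exact ⟨y, hyx, by rw [hy, hP.apply_range]⟩
  · rintro p ⟨h1, h2⟩
    simp [complexResolvent, hker _ h1, hker _ h2, h1, h2]
  · rintro p ⟨h1, h2⟩ q ⟨h3, h4⟩ hpq
    simp only [complexResolvent, hker _ h1, hker _ h2, hker _ h3, hker _ h4, sub_zero,
      Prod.mk.injEq] at hpq
    obtain ⟨ha, hb⟩ := hpq
    refine Prod.ext (hj ?_) (hj ?_)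
    · refine smul_right_injective _ (hz' hz) ?_
      simp only
      linear_combination (norm := module) (z.re : 𝕜) • ha + (z.im : 𝕜) • hb
    · refine smul_right_injective _ (hz' hz) ?_
      simp only
      linear_combination (norm := module) (z.re : 𝕜) • hb - (z.im : 𝕜) • ha
  · rintro q ⟨h1, h2⟩
    obtain ⟨n, hn, hnq⟩ := hP.range_le q.1
    obtain ⟨m, hm, hmq⟩ := hP.range_le q.2
    rw [h1] at hnq
    rw [h2] at hmq
    set d : 𝕜 := (z.re : 𝕜) * z.re + (z.im : 𝕜) * z.im with hd
    have hd0 : d ≠ 0 := hz' hz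
    -- Multiplication by `conj z / |z|²`, written in real and imaginary parts, with `d = |z|²`.
    refine ⟨(d⁻¹ • ((z.re : 𝕜) • n + (z.im : 𝕜) • m), d⁻¹ • ((z.re : 𝕜) • m - (z.im : 𝕜) • n)),
      ⟨hP.apply_ker _ (by simp [hn, hm]), hP.apply_ker _ (by simp [hn, hm])⟩, ?_⟩
    simp only [complexResolvent, map_smul, map_add, map_sub, hn, hm, smul_zero, add_zero, sub_zero,
      hnq, hmq]
    refine Prod.ext (smul_right_injective _ hd0 ?_) (smul_right_injective _ hd0 ?_)
    · simp only [smul_sub, smul_smul, smul_add]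
      match_scalars <;> field_simp <;> ring1
    · simp only [smul_sub, smul_smul, smul_add]
      match_scalars <;> field_simp <;> ring1
  · intro x _
    exact hP.apply_range x
  · intro x hx y hy hxy
    have h1 : A (x - y) = 0 := by rw [map_sub, hxy, sub_self]
    have h2 := hP.apply_ker _ h1
    rw [map_sub, map_sub, show P (j x) = 0 from hx, show P (j y) = 0 from hy, sub_zero] at h2
    exact hj (sub_eq_zero.1 h2.symm)
  · intro y hy
    obtain ⟨x, rfl⟩ := hP.ker_le y hy
    obtain ⟨n, hn, hnx⟩ := hP.range_le (j x)
    refine ⟨x - n, ?_, by rw [map_sub, hn, sub_zero]⟩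
    change P (j (x - n)) = 0
    rw [map_sub, map_sub, hP.apply_ker n hn, hnx, sub_self]

/-- For an operator with compact resolvent whose kernel meets its range trivially, the range is a
closed complement of the kernel. -/
theorem isCompl_ker_range_of_isCompactOperator [CompleteSpace E₀] (hj : IsCompactOperator j) {r : 𝕜}
    {e : E₁ ≃L[𝕜] E₀} (he : ∀ x, e x = r • j x - A x)
    (hdisj : ∀ x n, A n = 0 → A x = j n → A x = 0) :
    IsClosed (Set.range A) ∧
      IsCompl (A.toLinearMap.ker.map j.toLinearMap) A.toLinearMap.range := by
  set N := A.toLinearMap.ker.map j.toLinearMap with hN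
  -- `T` is compact with fixed space `N`, and `A e⁻¹ = T - 1`, so the range of `A` is that of `T -
  -- 1`.
  let T : E₀ →L[𝕜] E₀ := r • j.comp e.symm.toContinuousLinearMap
  have hT : IsCompactOperator T := (hj.comp_clm e.symm.toContinuousLinearMap).smul r
  have hTN : ∀ y, y ∈ N ↔ T y = y := mem_map_ker_iff_resolvent he
  have hAT : ∀ y, A (e.symm y) = T y - y := fun y => by
    have := he (e.symm y)
    rw [e.apply_symm_apply] at this
    change _ = r • j (e.symm y) - y
    exact (sub_eq_of_eq_add (eq_add_of_sub_eq this.symm |>.trans (add_comm _ _))).symm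
  have hfin : FiniteDimensional 𝕜 N := by
    have hTmem : ∀ v ∈ N, T.toLinearMap v ∈ N := fun v hv => by
      change T v ∈ N
      rwa [(hTN v).1 hv]
    have h1 := IsCompactOperator.restrict (f := T.toLinearMap) hT hTmem (isClosed_map_ker he)
    refine FiniteDimensional.of_isCompactOperator_id (𝕜 := 𝕜) ?_
    have hid : (id : N → N) = T.toLinearMap.restrict hTmem :=
      funext fun v => Subtype.ext ((hTN v).1 v.2).symm
    rw [hid]
    exact h1
  obtain ⟨f, hf⟩ := Submodule.ClosedComplemented.of_finiteDimensional (𝕜 := 𝕜) N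
  let Q : E₀ →L[𝕜] E₀ := N.subtypeL.comp f
  have hQ : IsCompactOperator Q := by
    have : ProperSpace N := FiniteDimensional.proper_rclike 𝕜 N
    have hf' : IsCompactOperator f := isCompactOperator_of_locallyCompactSpace_dom f
    exact hf'.clm_comp N.subtypeL
  have hQmem : ∀ y, Q y ∈ N := fun y => (f y).2
  have hQN : ∀ y ∈ N, Q y = y := fun y hy => congrArg Subtype.val (hf ⟨y, hy⟩)
  have hdisj' : ∀ x, A x ∈ N → A x = 0 := by
    rintro x ⟨n, hn, hnx⟩
    exact hdisj x n hn hnx.symm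
  -- Fredholm alternative for the compact operator `T - Q`: if it fixes `y`, then `A (e⁻¹ y) = Q y`
  -- lies in both range and kernel, hence vanishes; so `y ∈ N` and `y = Q y = 0`.
  have hbij : Function.Bijective (1 - (T - Q) : E₀ →L[𝕜] E₀) := by
    rcases (hT.sub hQ).hasEigenvalue_or_mem_resolventSet (T := T - Q) (one_ne_zero (α := 𝕜))
      with h | h
    · exfalso
      obtain ⟨y, hy⟩ := h.exists_hasEigenvector
      have hy1 : T y - Q y = y := by simpa using hy.apply_eq_smul
      have hy2 : A (e.symm y) = Q y := by rw [hAT, sub_eq_iff_eq_add, ← sub_eq_iff_eq_add', hy1]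
      have hy3 : A (e.symm y) = 0 := hdisj' _ (hy2 ▸ hQmem y)
      have hy4 : y ∈ N := (hTN y).2 (sub_eq_zero.1 ((hAT y).symm.trans hy3))
      exact hy.2 ((hQN y hy4).symm.trans (hy2.symm.trans hy3))
    · rw [spectrum.mem_resolventSet_iff, map_one] at h
      exact ContinuousLinearMap.isUnit_iff_bijective.1 h
  let S : E₀ ≃L[𝕜] E₀ := ContinuousLinearEquiv.ofBijective (1 - (T - Q))
    (LinearMap.ker_eq_bot.2 hbij.1) (LinearMap.range_eq_top.2 hbij.2)
  have hS : ∀ v, S v = Q v - A (e.symm v) := fun v => by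
    change v - (T v - Q v) = _
    rw [hAT]; abel
  -- With `v = S⁻¹ y` one has `y = Q v - A (e⁻¹ v)`, so `Q ∘ S⁻¹` extracts the kernel component; its
  -- zero set is the range, which is therefore closed.
  have hrange : Set.range A = {y | Q (S.symm y) = 0} := by
    ext y
    constructor
    · rintro ⟨x, rfl⟩
      have h1 : S (Q (e x) - e x) = A x := by
        rw [hS, map_sub, map_sub, map_sub, hQN _ (hQmem _), hAT,
          (hTN _).1 (hQmem _), e.symm_apply_apply]
        abel
      change Q (S.symm (A x)) = 0
      rw [← h1, S.symm_apply_apply, map_sub, hQN _ (hQmem _), sub_self]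
    · intro hy
      have h1 := hS (S.symm y)
      rw [S.apply_symm_apply, show Q (S.symm y) = 0 from hy, zero_sub, ← map_neg] at h1
      exact ⟨_, h1.symm⟩
  refine ⟨?_, ?_⟩
  · rw [hrange]
    exact isClosed_eq (by fun_prop) continuous_const
  · refine ⟨?_, ?_⟩
    · rw [Submodule.disjoint_def]
      rintro y hy ⟨x, rfl⟩
      exact hdisj' x hy
    · rw [codisjoint_iff, eq_top_iff]
      intro y _
      have h1 := hS (S.symm y)
      rw [S.apply_symm_apply, sub_eq_add_neg, ← map_neg] at h1
      exact Submodule.mem_sup.2 ⟨_, hQmem _, _, ⟨_, rfl⟩, h1.symm⟩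

end semisimple

/-! ### Transfer of semi-simplicity from the upper to the lower level -/

section transfer
variable {𝕜 : Type} [RCLike 𝕜] {X₀ X₁ X₄ X₅ : Type*}
  [NormedAddCommGroup X₀] [NormedSpace 𝕜 X₀] [CompleteSpace X₀]
  [NormedAddCommGroup X₁] [NormedSpace 𝕜 X₁] [CompleteSpace X₁]
  [NormedAddCommGroup X₄] [NormedSpace 𝕜 X₄] [CompleteSpace X₄]
  [NormedAddCommGroup X₅] [NormedSpace 𝕜 X₅] [CompleteSpace X₅]

/-- Let `X₅ ↪ X₄ ↪ X₁ ↪ X₀`, and let `B₁ : X₅ → X₁` be a restriction of `B₀ : X₄ → X₀`. If both are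
generators and `X₄ ↪ X₀` is compact, then semi-simplicity of the eigenvalue `0` and the kernel
projection of `B₁` carry over to `B₀`. -/
theorem IsSemisimpleEigenvalueZero.extend {i₀₁ : X₁ →L[𝕜] X₀} {i₁₄ : X₄ →L[𝕜] X₁}
    {i₄₅ : X₅ →L[𝕜] X₄} {j₀ : X₄ →L[𝕜] X₀} {j₁ : X₅ →L[𝕜] X₁}
    (hj₀ : ∀ x, i₀₁ (i₁₄ x) = j₀ x) (hj₁ : ∀ x, i₁₄ (i₄₅ x) = j₁ x)
    (h₀₁ : Function.Injective i₀₁) (h₄₅ : Function.Injective i₄₅)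
    {B₁ : X₅ →L[𝕜] X₁} {B₀ : X₄ →L[𝕜] X₀} (hB : ∀ x, i₀₁ (B₁ x) = B₀ (i₄₅ x))
    (hg₁ : IsAnalyticGenerator j₁ B₁) (hg₀ : IsAnalyticGenerator j₀ B₀)
    (hcomp : IsCompactOperator j₀) (hs : IsSemisimpleEigenvalueZero j₁ B₁) :
    IsSemisimpleEigenvalueZero j₀ B₀ ∧
    ∃ (P₁ : X₁ →L[𝕜] X₁) (P₀ : X₀ →L[𝕜] X₀),
      IsKernelProjection j₁ B₁ P₁ ∧ IsKernelProjection j₀ B₀ P₀ ∧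
      (∀ y, P₀ (i₀₁ y) = i₀₁ (P₁ y)) ∧
      (∀ y, (∃ v, P₀ v = y) ↔ ∃ v, i₀₁ (P₁ v) = y) ∧
      ∃ C : ℝ, ∀ y, ∃ x, B₁ x = 0 ∧ i₀₁ (j₁ x) = P₀ y ∧ ‖x‖ ≤ C * ‖P₀ y‖ := by
  obtain ⟨ω₁, hω₁⟩ := hg₁.exists_resolvent
  obtain ⟨ω₀, hω₀⟩ := hg₀.exists_resolvent
  obtain ⟨e₁, he₁⟩ := hω₁ _ (le_max_left ω₁ ω₀)
  obtain ⟨e₀, he₀⟩ := hω₀ _ (le_max_right ω₁ ω₀)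
  set r : 𝕜 := ((max ω₁ ω₀ : ℝ) : 𝕜)
  have hj : ∀ x, j₀ (i₄₅ x) = i₀₁ (j₁ x) := fun x => by rw [← hj₀, hj₁]
  -- Regularity: if `B₀ x = w ∈ X₁`, then `(r - B₀) x = r x - w` lies in `X₁`. Solving this equation
  -- with `r - B₁` gives a point of `X₅`, equal to `x` by injectivity of `r - B₀`.
  have regular : ∀ x w, B₀ x = i₀₁ w → ∃ x', i₄₅ x' = x ∧ B₁ x' = w := fun x w hxw => by
    have h1 : i₄₅ (e₁.symm (r • i₁₄ x - w)) = x := e₀.injective (by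
      rw [he₀, hj, ← hB, ← map_smul, ← map_sub, ← he₁, e₁.apply_symm_apply, he₀, map_sub, map_smul,
        hj₀, hxw])
    exact ⟨_, h1, h₀₁ (by rw [hB, h1, hxw])⟩
  have regular_ker : ∀ x, B₀ x = 0 → ∃ x', i₄₅ x' = x ∧ B₁ x' = 0 := fun x hx =>
    regular x 0 (by rw [hx, map_zero])
  have hdisj : ∀ x n, B₀ n = 0 → B₀ x = j₀ n → B₀ x = 0 := fun x n hn hx => by
    obtain ⟨n', rfl, hn'⟩ := regular_ker n hn
    rw [hj] at hx
    obtain ⟨x', rfl, hx'⟩ := regular x _ hx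
    have h1 : j₁ n' = 0 := (Submodule.disjoint_def.1 hs.compl.disjoint) _ ⟨n', hn', rfl⟩ ⟨x', hx'⟩
    rw [hx, h1, map_zero]
  obtain ⟨hclosed, hcompl⟩ := isCompl_ker_range_of_isCompactOperator hcomp he₀ hdisj
  obtain ⟨x, hx0, hx⟩ := hs.eigenvalue
  have hs₀ : IsSemisimpleEigenvalueZero j₀ B₀ :=
    ⟨⟨i₄₅ x, fun h => hx0 (h₄₅ (h.trans (map_zero _).symm)), by rw [← hB, hx, map_zero]⟩,
      hclosed, hcompl⟩
  obtain ⟨P₁, hP₁⟩ := hs.exists_isKernelProjection he₁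
  obtain ⟨P₀, hP₀⟩ := hs₀.exists_isKernelProjection he₀
  have hext : ∀ y, P₀ (i₀₁ y) = i₀₁ (P₁ y) := fun y => by
    -- The splitting of `y` into kernel and range of `B₁` is also one for `B₀`, so both projections
    -- pick the same component.
    obtain ⟨n, hn, hny⟩ := hP₁.range_le y
    obtain ⟨x, hx⟩ := hP₁.ker_le (y - P₁ y) (by rw [← hny, map_sub, hP₁.apply_ker n hn, hny, sub_self])
    have hy : i₀₁ y = j₀ (i₄₅ n) + B₀ (i₄₅ x) := by
      rw [hj, ← hB, ← map_add, hx, hny, add_sub_cancel]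
    rw [hy, map_add, hP₀.apply_range, add_zero, hP₀.apply_ker _ (by rw [← hB, hn, map_zero]), hj, hny]
  refine ⟨hs₀, P₁, P₀, hP₁, hP₀, hext, fun y => ⟨?_, ?_⟩, ?_⟩
  · rintro ⟨v, rfl⟩
    obtain ⟨n, hn, hnv⟩ := hP₀.range_le v
    obtain ⟨n', rfl, hn'⟩ := regular_ker n hn
    exact ⟨j₁ n', by rw [hP₁.apply_ker n' hn', ← hj, hnv]⟩
  · rintro ⟨v, rfl⟩
    exact ⟨_, hext v⟩
  -- Each factor `r (r - B)⁻¹` is the identity on the kernel. Composing the one of `B₀` with the one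
  -- of `B₁` gives a bounded map `X₀ → X₅` that fixes kernel elements, and its norm is the embedding
  -- constant.
  · let S : X₀ →L[𝕜] X₅ := e₁.symm.toContinuousLinearMap.comp
      ((r • i₁₄).comp (e₀.symm.toContinuousLinearMap.comp (r • ContinuousLinearMap.id 𝕜 X₀)))
    refine ⟨‖S‖, fun y => ?_⟩
    obtain ⟨n, hn, hny⟩ := hP₀.range_le y
    obtain ⟨x, rfl, hx⟩ := regular_ker n hn
    refine ⟨x, hx, by rw [← hj, hny], ?_⟩
    have h1 : e₀.symm (r • j₀ (i₄₅ x)) = i₄₅ x := by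
      rw [e₀.symm_apply_eq, he₀, hn, sub_zero]
    have h2 : e₁.symm (r • j₁ x) = x := by
      rw [e₁.symm_apply_eq, he₁, hx, sub_zero]
    have h3 : S (P₀ y) = x := by
      change e₁.symm (r • i₁₄ (e₀.symm (r • P₀ y))) = x
      rw [← hny, h1, hj₁, h2]
    calc ‖x‖ = ‖S (P₀ y)‖ := by rw [h3]
      _ ≤ ‖S‖ * ‖P₀ y‖ := S.le_opNorm _

end transfer

/-! ### Compatibility of derivatives and local Lipschitz bounds -/

section derivative
variable {𝕜 : Type} [RCLike 𝕜] {X₀ X₁ X₂ X₃ X₄ X₅ : Type*}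
  [NormedAddCommGroup X₀] [NormedSpace 𝕜 X₀] [NormedAddCommGroup X₁] [NormedSpace 𝕜 X₁]
  [NormedAddCommGroup X₂] [NormedSpace 𝕜 X₂] [NormedAddCommGroup X₃] [NormedSpace 𝕜 X₃]
  [NormedAddCommGroup X₄] [NormedSpace 𝕜 X₄] [NormedAddCommGroup X₅] [NormedSpace 𝕜 X₅]

/-- Near `w` both sides come from differentiating the single function `v ↦ A₀ (i₂₃ v) (i₄₅ x)`, and
derivatives are unique. -/
theorem fderiv_apply_of_intertwining {i₀₁ : X₁ →L[𝕜] X₀} {i₂₃ : X₃ →L[𝕜] X₂} {i₄₅ : X₅ →L[𝕜] X₄}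
    {O : Set X₂} (hO : IsOpen O) {A₀ : X₂ → X₄ →L[𝕜] X₀} {A₁ : X₃ → X₅ →L[𝕜] X₁}
    (hA : ∀ w, i₂₃ w ∈ O → ∀ x, i₀₁ (A₁ w x) = A₀ (i₂₃ w) (i₄₅ x)) {w : X₃} (hw : i₂₃ w ∈ O)
    (hA₀ : DifferentiableAt 𝕜 A₀ (i₂₃ w)) (hA₁ : DifferentiableAt 𝕜 A₁ w) (h : X₃) (x : X₅) :
    i₀₁ (fderiv 𝕜 A₁ w h x) = fderiv 𝕜 A₀ (i₂₃ w) (i₂₃ h) (i₄₅ x) := by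
  have h1 := (i₀₁.comp (ContinuousLinearMap.apply 𝕜 X₁ x)).hasFDerivAt.comp w hA₁.hasFDerivAt
  have h2 := (ContinuousLinearMap.apply 𝕜 X₀ (i₄₅ x)).hasFDerivAt.comp w
    (hA₀.hasFDerivAt.comp w i₂₃.hasFDerivAt)
  have h3 := h1.congr_of_eventuallyEq (f₁ := fun v => A₀ (i₂₃ v) (i₄₅ x))
    (Filter.eventually_of_mem ((hO.preimage i₂₃.continuous).mem_nhds hw)
      fun v hv => (hA v hv x).symm)
  exact congrArg (fun T : X₃ →L[𝕜] X₀ => T h) (h3.unique h2)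

/-- One of the two points stays at `w₀`, so differentiability there suffices. -/
theorem ContDiffOn.exists_norm_sub_le {O : Set X₂} (hO : IsOpen O) {F : X₂ → X₃}
    (hF : ContDiffOn 𝕜 1 F O) {w₀ : X₂} (hw₀ : w₀ ∈ O) :
    ∃ U ⊆ O, IsOpen U ∧ w₀ ∈ U ∧ ∃ L : ℝ, 0 ≤ L ∧ ∀ w ∈ U, ‖F w - F w₀‖ ≤ L * ‖w - w₀‖ := by
  have hd : DifferentiableAt 𝕜 F w₀ :=
    (hF.contDiffAt (hO.mem_nhds hw₀)).differentiableAt one_ne_zero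
  obtain ⟨L, hL0, hL⟩ := hd.isBigO_sub.exists_pos
  obtain ⟨V, hV, hVo, hwV⟩ := eventually_nhds_iff.1 hL.bound
  exact ⟨V ∩ O, Set.inter_subset_right, hVo.inter hO, ⟨hwV, hw₀⟩, L, hL0.le, fun w hw => hV w hw.1⟩

end derivative

/-! ### The linearization on the interpolation scale and the main theorem -/

namespace InjectedCouple
variable {𝕜 : Type} [RCLike 𝕜]

/-- Since `s < t` strictly, the `E_s` norm obeys an interpolation inequality with weight `l < 1` on
the `E_t` norm, so a term bounded on `E_s` is of lower order. -/
theorem isAnalyticGenerator_of_lower_order (D : InjectedCouple.{u} 𝕜) (I : AdmissibleFamily.{u} 𝕜)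
    {r s t : unitInterval} (hrs : r < s) (hst : s < t) {A B : D.space I t →L[𝕜] D.space I r}
    (hA : IsAnalyticGenerator (D.incl I (hrs.trans hst)) A) (R : D.space I s →L[𝕜] D.space I r)
    (hB : ∀ x, B x = A x + R (D.incl I hst x)) :
    IsAnalyticGenerator (D.incl I (hrs.trans hst)) B := by
  have hrs' : (r : ℝ) < s := hrs
  have hst' : (s : ℝ) < t := hst
  have hrt' : 0 < (t : ℝ) - r := by linarith
  set m : ℝ := (s - r) / (t - r) with hm
  have hm0 : 0 < m := div_pos (by linarith) hrt'
  have hmeq : m * (t - r) = s - r := div_mul_cancel₀ _ hrt'.ne'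
  have hm1 : m < 1 := by
    rw [hm, div_lt_one hrt']
    linarith
  set l : ℝ := (m + 1) / 2 with hl
  have hl1 : l < 1 := by rw [hl]; linarith
  have hml : m < l := by rw [hl]; linarith
  have hl0 : 0 ≤ l := by linarith
  obtain ⟨C, hC0, hC⟩ := D.norm_incl_le_interpolation I hrs hst (l := l) ⟨hl0, hl1.le⟩ (by nlinarith)
  have hB' : B = A + R.comp (D.incl I hst) := ContinuousLinearMap.ext hB
  rw [hB']
  refine hA.add (C := ‖R‖ * C) hl0 hl1 fun x => ?_
  calc ‖R (D.incl I hst x)‖ ≤ ‖R‖ * ‖D.incl I hst x‖ := R.le_opNorm _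
    _ ≤ ‖R‖ * (C * (‖D.incl I (hrs.trans hst) x‖ ^ (1 - l) * ‖x‖ ^ l)) :=
      mul_le_mul_of_nonneg_left (hC x) (norm_nonneg _)
    _ = _ := by ring

/-- Provides `u_*` as a point of `E_β`. -/
theorem exists_subcouple_space_eq (D : InjectedCouple.{u} 𝕜) (I J : AdmissibleFamily.{u} 𝕜)
    {s t : unitInterval} (hst : s < t) (β : unitInterval) (x : D.space I t) :
    ∃ v : (D.subcouple I hst).space J β, (D.subcouple I hst).toBase J β v = D.incl I hst x := by
  obtain ⟨C, -, hC⟩ := (D.subcouple I hst).exists_lift (J.hasExponent_ext β) β.2.1 β.2.2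
  obtain ⟨v, hv, -⟩ := hC x
  exact ⟨v, hv⟩

end InjectedCouple

theorem proposition4p3 {𝕜 : Type} [RCLike 𝕜]
    -- a densely and compactly injected Banach couple, and its interpolation spaces `D.space I θ`
    (D : InjectedCouple.{u} 𝕜) (hdense : DenseRange D.inj) (hcompact : IsCompactOperator D.inj)
    (I : AdmissibleFamily.{u} 𝕜)
    -- `0 ≤ θ 0 < θ 1 < ⋯ < θ 5 ≤ 1`
    (θ : Fin 6 → unitInterval)
    (h01 : θ 0 < θ 1) (h12 : θ 1 < θ 2) (h23 : θ 2 < θ 3) (h34 : θ 3 < θ 4) (h45 : θ 4 < θ 5)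
    -- an open set `O` of `F_{θ 2}`; its part in `F_{θ 3}` is `D.incl I h23 ⁻¹' O`
    (O : Set (D.space I (θ 2))) (hO : IsOpen O)
    -- the operator function `A`, once on `O` (`A₀`) and once on `O ∩ F_{θ 3}` (`A₁`)
    (A₀ : D.space I (θ 2) → (D.space I (θ 4) →L[𝕜] D.space I (θ 0)))
    (A₁ : D.space I (θ 3) → (D.space I (θ 5) →L[𝕜] D.space I (θ 1)))
    (hA : ∀ w, D.incl I h23 w ∈ O → ∀ x,
      D.incl I h01 (A₁ w x) = A₀ (D.incl I h23 w) (D.incl I h45 x))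
    (hA₀ : ContDiffOn 𝕜 1 A₀ O)
    (hA₀gen : ∀ w ∈ O,
      IsAnalyticGenerator (D.incl I (h01.trans (h12.trans (h23.trans h34)))) (A₀ w))
    (hA₁ : ContDiffOn 𝕜 1 A₁ (D.incl I h23 ⁻¹' O))
    (hA₁gen : ∀ w ∈ D.incl I h23 ⁻¹' O,
      IsAnalyticGenerator (D.incl I (h12.trans (h23.trans (h34.trans h45)))) (A₁ w))
    (f : D.space I (θ 3) → D.space I (θ 1))
    (hf : ContDiffOn 𝕜 1 f (D.incl I h23 ⁻¹' O))
    (u : D.space I (θ 5)) (hu : D.incl I (h23.trans (h34.trans h45)) u ∈ O)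
    -- the linearization at `u`, from `F_{θ 5}` to `F_{θ 1}` and from `F_{θ 4}` to `F_{θ 0}`
    (B₁ : D.space I (θ 5) →L[𝕜] D.space I (θ 1))
    (hB₁ : ∀ x, B₁ x = A₁ (D.incl I (h34.trans h45) u) x
      + fderiv 𝕜 A₁ (D.incl I (h34.trans h45) u) (D.incl I (h34.trans h45) x) u
      + fderiv 𝕜 f (D.incl I (h34.trans h45) u) (D.incl I (h34.trans h45) x))
    (B₀ : D.space I (θ 4) →L[𝕜] D.space I (θ 0))
    (hB₀ : ∀ x, B₀ x = A₀ (D.incl I (h23.trans (h34.trans h45)) u) x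
      + fderiv 𝕜 A₀ (D.incl I (h23.trans (h34.trans h45)) u) (D.incl I (h23.trans h34) x)
          (D.incl I h45 u)
      + D.incl I h01 (fderiv 𝕜 f (D.incl I (h34.trans h45) u) (D.incl I h34 x))) :
    -- the two linearizations are restrictions of one operator, and both are generators
    (∀ x, D.incl I h01 (B₁ x) = B₀ (D.incl I h45 x)) ∧
    IsAnalyticGenerator (D.incl I (h12.trans (h23.trans (h34.trans h45)))) B₁ ∧
    IsAnalyticGenerator (D.incl I (h01.trans (h12.trans (h23.trans h34)))) B₀ ∧
    -- if `0` is a semi-simple eigenvalue at the upper level, then also at the lower level, and so on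
    (IsSemisimpleEigenvalueZero (D.incl I (h12.trans (h23.trans (h34.trans h45)))) B₁ →
    IsSemisimpleEigenvalueZero (D.incl I (h01.trans (h12.trans (h23.trans h34)))) B₀ ∧
    -- the spectral projections `P₁` on `F_{θ 1}` and `P₀` on `F_{θ 0}`; `P₀` extends `P₁`
    (∃ (P₁ : D.space I (θ 1) →L[𝕜] D.space I (θ 1)) (P₀ : D.space I (θ 0) →L[𝕜] D.space I (θ 0)),
      IsSpectralProjectionZero (D.incl I (h12.trans (h23.trans (h34.trans h45)))) B₁ P₁ ∧
      IsSpectralProjectionZero (D.incl I (h01.trans (h12.trans (h23.trans h34)))) B₀ P₀ ∧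
      (∀ y, P₀ (D.incl I h01 y) = D.incl I h01 (P₁ y)) ∧
      -- `P₁ (F_{θ 1})` and `P₀ (F_{θ 0})` are both the kernel of the linearization
      (∀ y, (∃ v, P₁ v = y) ↔
        ∃ x, B₁ x = 0 ∧ D.incl I (h12.trans (h23.trans (h34.trans h45))) x = y) ∧
      (∀ y, (∃ v, P₀ v = y) ↔
        ∃ x, B₀ x = 0 ∧ D.incl I (h01.trans (h12.trans (h23.trans h34))) x = y) ∧
      (∀ y, (∃ v, P₀ v = y) ↔ ∃ v, D.incl I h01 (P₁ v) = y) ∧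
      -- continuous embedding of `P₀ (F_{θ 0})` into the kernel, the latter with the norm of `F_{θ 5}`
      (∃ C : ℝ, ∀ y, ∃ x, B₁ x = 0 ∧
        D.incl I (h01.trans (h12.trans (h23.trans (h34.trans h45)))) x = P₀ y ∧
        ‖x‖ ≤ C * ‖P₀ y‖)) ∧
    -- Lipschitz estimate near `u`, in the norm of `F_{θ 2}`
    (∃ U ⊆ O, IsOpen U ∧ D.incl I (h23.trans (h34.trans h45)) u ∈ U ∧ ∃ L : ℝ, ∀ w ∈ U,
      ‖A₀ w - A₀ (D.incl I (h23.trans (h34.trans h45)) u)‖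
        ≤ L * ‖w - D.incl I (h23.trans (h34.trans h45)) u‖) ∧
    -- the spaces `E_ζ` and `E_β` of the couple `(E₀, E₁) = (F_{θ 1}, F_{θ 5})`, for any admissible
    -- interpolation functors
    (∀ J : AdmissibleFamily.{u} 𝕜,
      -- `E_ζ ↪ F_{θ 4}` for some `ζ ∈ [0,1)`
      (∃ ζ : unitInterval, ζ < 1 ∧
        ∃ k : (D.subcouple I (h12.trans (h23.trans (h34.trans h45)))).space J ζ
            →L[𝕜] D.space I (θ 4),
          ∀ x, D.incl I (h12.trans (h23.trans h34)) (k x) =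
            (D.subcouple I (h12.trans (h23.trans (h34.trans h45)))).toBase J ζ x) ∧
      -- for `β ∈ (0,1)` above the level of `F_{θ 2}`: `E_β ↪ F_{θ 2}`, `u ∈ E_β`, and the Lipschitz
      -- estimate holds in the norm of `E_β` on a neighbourhood `U` of `u` in `E_β`
      (∀ β : unitInterval, 0 < β → β < 1 →
        (θ 2 : ℝ) < (1 - (β : ℝ)) * (θ 1 : ℝ) + (β : ℝ) * (θ 5 : ℝ) →
        ∃ (k : (D.subcouple I (h12.trans (h23.trans (h34.trans h45)))).space J β
            →L[𝕜] D.space I (θ 2))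
          (v : (D.subcouple I (h12.trans (h23.trans (h34.trans h45)))).space J β),
          (∀ x, D.incl I h12 (k x) =
            (D.subcouple I (h12.trans (h23.trans (h34.trans h45)))).toBase J β x) ∧
          k v = D.incl I (h23.trans (h34.trans h45)) u ∧
          ∃ U, IsOpen U ∧ v ∈ U ∧ (∀ w ∈ U, k w ∈ O) ∧
            ∃ L : ℝ, ∀ w ∈ U, ‖A₀ (k w) - A₀ (k v)‖ ≤ L * ‖w - v‖))) := by
  have hwO : D.incl I h23 (D.incl I (h34.trans h45) u) ∈ O := by rwa [D.incl_incl]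
  have hO' : IsOpen (D.incl I h23 ⁻¹' O) := hO.preimage (D.incl I h23).continuous
  have hd₀ : DifferentiableAt 𝕜 A₀ (D.incl I (h23.trans (h34.trans h45)) u) :=
    (hA₀.contDiffAt (hO.mem_nhds hu)).differentiableAt one_ne_zero
  have hd₁ : DifferentiableAt 𝕜 A₁ (D.incl I (h34.trans h45) u) :=
    (hA₁.contDiffAt (hO'.mem_nhds hwO)).differentiableAt one_ne_zero
  have hB : ∀ x, D.incl I h01 (B₁ x) = B₀ (D.incl I h45 x) := fun x => by
    have h1 := fderiv_apply_of_intertwining hO hA hwO (by rwa [D.incl_incl]) hd₁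
      (D.incl I (h34.trans h45) x) u
    have h2 := hA _ hwO x
    rw [D.incl_incl] at h1 h2
    rw [hB₁, hB₀, map_add, map_add, h1, h2, D.incl_incl, D.incl_incl, D.incl_incl]
  -- The perturbation is `h ↦ ∂A₁(u_*)[h] u_* + ∂f(u_*) h`, bounded from `F_{θ 3}` to `F_{θ 1}`.
  have hg₁ : IsAnalyticGenerator (D.incl I (h12.trans (h23.trans (h34.trans h45)))) B₁ :=
    D.isAnalyticGenerator_of_lower_order I (h12.trans h23) (h34.trans h45) (hA₁gen _ hwO)
      ((fderiv 𝕜 A₁ (D.incl I (h34.trans h45) u)).flip u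
        + fderiv 𝕜 f (D.incl I (h34.trans h45) u)) fun x => by
      rw [hB₁, add_assoc]; rfl
  -- The derivative of `A₀` is bounded already on `F_{θ 2}`, but that of `f` only on `F_{θ 3}`, so
  -- `F_{θ 3}` is again the intermediate space.
  have hg₀ : IsAnalyticGenerator (D.incl I (h01.trans (h12.trans (h23.trans h34)))) B₀ :=
    D.isAnalyticGenerator_of_lower_order I (h01.trans (h12.trans h23)) h34 (hA₀gen _ hu)
      (((fderiv 𝕜 A₀ (D.incl I (h23.trans (h34.trans h45)) u)).flip (D.incl I h45 u)).comp
          (D.incl I h23)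
        + (D.incl I h01).comp (fderiv 𝕜 f (D.incl I (h34.trans h45) u))) fun x => by
      rw [hB₀, add_assoc, ← D.incl_incl I h23 h34]; rfl
  refine ⟨hB, hg₁, hg₀, fun hs => ?_⟩
  obtain ⟨hs₀, P₁, P₀, hP₁, hP₀, hext, hrange, C, hC⟩ := hs.extend
    (D.incl_incl I h01 (h12.trans (h23.trans h34)))
    (D.incl_incl I (h12.trans (h23.trans h34)) h45)
    (D.incl_injective I h01) (D.incl_injective I h45) hB hg₁ hg₀ (D.isCompactOperator_incl hcompact I _)
  obtain ⟨U, hUO, hU, huU, L, hL0, hL⟩ := hA₀.exists_norm_sub_le hO hu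
  refine ⟨hs₀, ⟨P₁, P₀, hP₁.isSpectralProjectionZero (D.incl_injective I _),
    hP₀.isSpectralProjectionZero (D.incl_injective I _), hext, hP₁.range_iff, hP₀.range_iff, hrange,
    C, fun y => ?_⟩, ⟨U, hUO, hU, huU, L, hL⟩, fun J => ⟨?_, fun β _ _ hβ => ?_⟩⟩
  · obtain ⟨x, hx, hxy, hxn⟩ := hC y
    exact ⟨x, hx, by rwa [D.incl_incl] at hxy, hxn⟩
  · have h14 : (θ 1 : ℝ) < θ 4 := h12.trans (h23.trans h34)
    have h45' : (θ 4 : ℝ) < θ 5 := h45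
    have h15' : 0 < (θ 5 : ℝ) - θ 1 := by linarith
    set m : ℝ := ((θ 4 : ℝ) - θ 1) / (θ 5 - θ 1) with hm
    have hm0 : 0 < m := div_pos (by linarith) h15'
    have hmeq : m * ((θ 5 : ℝ) - θ 1) = θ 4 - θ 1 := div_mul_cancel₀ _ h15'.ne'
    have hm1 : m < 1 := by
      rw [hm, div_lt_one h15']
      linarith
    -- `m` is the relative position of `θ 4` in `[θ 1, θ 5]`. Reiteration needs `ζ > m`, and the
    -- midpoint to 1 leaves room on both sides.
    refine ⟨⟨(m + 1) / 2, by linarith, by linarith⟩, ?_, D.exists_subcouple_incl I J _ h45 ?_⟩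
    · change (m + 1) / 2 < 1
      linarith
    · change (θ 4 : ℝ) < (1 - (m + 1) / 2) * θ 1 + (m + 1) / 2 * θ 5
      nlinarith
  · obtain ⟨k, hk⟩ := D.exists_subcouple_incl I J h12 (h23.trans (h34.trans h45)) hβ
    obtain ⟨v, hv⟩ := D.exists_subcouple_space_eq I J (h12.trans (h23.trans (h34.trans h45))) β u
    have hkv : k v = D.incl I (h23.trans (h34.trans h45)) u :=
      D.incl_injective I h12 (by rw [hk, hv, D.incl_incl])
    -- The neighbourhood and the estimate are pulled back along the embedding `k`, which multiplies
    -- the Lipschitz constant by `‖k‖`.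
    refine ⟨k, v, hk, hkv, k ⁻¹' U, hU.preimage k.continuous, ?_, fun w hw => hUO hw,
      L * ‖k‖, fun w hw => ?_⟩
    · rwa [Set.mem_preimage, hkv]
    · rw [hkv]
      refine (hL _ hw).trans ?_
      rw [← hkv, ← map_sub, mul_assoc]
      exact mul_le_mul_of_nonneg_left (k.le_opNorm _) hL0
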